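/- Let $e(y)=e^{2\pi i y}$, and let $\mathcal{M}_1$ be the set of all multiplicative arithmetic functions $f$ (that is, $f(1)=1$ and $f(mn)=f(m)f(n)$ whenever $\gcd(m,n)=1$) with values in $\mathbb{C}$ such that $|f(n)|=1$ for all positive integers $n$. For a positive integer $k$ let $\phi_k$ and $\sigma_k$ denote the $k$-th iterates (under composition) of Euler's totient function $\phi$ and of the sum-of-divisors function $\sigma$. Fix a positive integer $k$. Then for almost all real numbers $\alpha\in(0,1)$ (with respect to Lebesgue measure), $$\sup_{f\in\mathcal{M}_1}\frac1x\left|\sum_{n\le x} f(n)\,e(\alpha\,\phi_k(n))\right|\to 0 \qquad\text{and}\qquad \sup_{f\in\mathcal{M}_1}\frac1x\left|\sum_{n\le x} f(n)\,e(\alpha\,\sigma_k(n))\right|\to 0$$ as $x\to\infty$, where the sums run over positive integers $n\le x$. -/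

import Mathlib

open Filter Topology MeasureTheory

noncomputable section

namespace IterateSums

/-- `e(y) = exp(2πiy)`. -/
def e (y : ℝ) : ℂ := Complex.exp (2 * Real.pi * Complex.I * y)

/-- The set of multiplicative arithmetic functions `f : ℕ → ℂ` with `|f(n)| = 1` for all `n ≥ 1`
(the value at `0` of an `ArithmeticFunction` is `0` by convention and never enters below). -/
def M₁ : Set (ArithmeticFunction ℂ) :=
  {f | f.IsMultiplicative ∧ ∀ n : ℕ, 1 ≤ n → ‖f n‖ = 1}

/-- The `k`-th iterate `φ_k` of Euler's totient function. -/
def phiIter (k : ℕ) : ℕ → ℕ := Nat.totient^[k]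

/-- The `k`-th iterate `σ_k` of the sum-of-divisors function. -/
def sigmaIter (k : ℕ) : ℕ → ℕ := (fun n : ℕ => ArithmeticFunction.sigma 1 n)^[k]

/-- The average `(1/x) |∑_{1 ≤ n ≤ x} f(n) e(α a(n))|`. -/
def twistedMean (a : ℕ → ℕ) (α : ℝ) (x : ℝ) (f : ArithmeticFunction ℂ) : ℝ :=
  (1 / x) * ‖∑ n ∈ Finset.Icc 1 ⌊x⌋₊, f n * e (α * (a n : ℝ))‖

/-- The supremum of `twistedMean a α x f` over `f ∈ M₁`. For `x > 0` it is the supremum of a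
nonempty bounded set of reals, by `M₁_nonempty` and `bddAbove_twistedMean`. -/
def supTwistedMean (a : ℕ → ℕ) (α : ℝ) (x : ℝ) : ℝ :=
  sSup (twistedMean a α x '' M₁)

theorem M₁_nonempty : M₁.Nonempty := by
  refine ⟨((ArithmeticFunction.zeta : ArithmeticFunction ℕ) : ArithmeticFunction ℂ),
    ArithmeticFunction.isMultiplicative_zeta.natCast, ?_⟩
  intro n hn
  have h0 : n ≠ 0 := by omega
  simp [ArithmeticFunction.natCoe_apply, ArithmeticFunction.zeta_apply, h0]

theorem norm_e (y : ℝ) : ‖e y‖ = 1 := by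
  have h : (2 * Real.pi * Complex.I * y : ℂ) = ((2 * Real.pi * y : ℝ) : ℂ) * Complex.I := by
    push_cast
    ring
  rw [e, h, Complex.norm_exp_ofReal_mul_I]

theorem bddAbove_twistedMean (a : ℕ → ℕ) (α x : ℝ) (hx : 0 < x) :
    BddAbove (twistedMean a α x '' M₁) := by
  refine ⟨1, ?_⟩
  rintro _ ⟨f, hf, rfl⟩
  have h1 : ‖∑ n ∈ Finset.Icc 1 ⌊x⌋₊, f n * e (α * (a n : ℝ))‖ ≤ x := by
    calc ‖∑ n ∈ Finset.Icc 1 ⌊x⌋₊, f n * e (α * (a n : ℝ))‖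
        ≤ ∑ n ∈ Finset.Icc 1 ⌊x⌋₊, (1 : ℝ) := by
          refine norm_sum_le_of_le _ fun n hn => ?_
          rw [norm_mul, norm_e, hf.2 n (Finset.mem_Icc.mp hn).1, one_mul]
      _ = (⌊x⌋₊ : ℝ) := by simp
      _ ≤ x := Nat.floor_le hx.le
  rw [twistedMean, one_div, inv_mul_le_iff₀ hx, mul_one]
  exact h1

end IterateSums

end

namespace IterateSums

open Finset ComplexConjugate
open scoped Classical

/-! Both functions are treated as a `g` with `IsShiftLike g`. Write `a = g^[i + 1]`, `F n = f n * e
(α * a n)`, and `w` for the binary length of `N`. As in the method of Daboussi and Kátai,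
Turán–Kubilius compares `L * ∑ F n` with `∑ p, ∑ m, F (p * m)`, where `p` runs over primes whose
reciprocal sum `L` is large. Since `f (p * m) = f p * f m` for `p ∤ m`, Cauchy–Schwarz
(`norm_bilinear_pow_four_le`) removes `f`. Only the sums over `m` of `e (α * (a (p * m) - a (q *
m)))` remain, hence the uniformity in `f`.

By Parseval, their mean square over `α` counts coincidences between the differences `a (p * m) - a
(q * m)`. A nonzero value is taken rarely (`card_chained_solutions_le`): if `m = r * s` with `r` a
large prime, then `g (H * r * s) = g (H * s) * g r` is linear in `g r`, so `s` nearly determines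
`r`, and there are few `s`. For iterates the argument is repeated with `g r` in place of `m` and `g
(H * s)` in place of `H`. This needs a large prime factor of `g r`, and so on, which is what
`Chained` provides. Zero differences are rare too: for fixed `q` and `m`, `a (p * m) = a (q * m)` is
an equation of the same type in `p`, which is therefore also taken chained.

The threshold `Y` is about a power of `w`, enough to beat all logarithmic losses, yet so small that
almost all integers are chained (`card_not_chained_le`) and the chained primes keep a divergent
reciprocal sum (`sum_chainedPrimes_inv_ge`). The normalised correlation then has integral `O(w⁻⁴)`,
summable along `N = ⌊exp √s⌋`. So it tends to `0` along this sequence for almost every `α`, and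
consecutive terms are close enough to fill the gaps. -/

/-! ### Shift-like functions and chains of primes -/

/-- The properties shared by Euler's totient function and the sum-of-divisors function:
multiplicative, equal to a shift by at most one on the primes, positive and at most quadratic. -/
structure IsShiftLike (g : ℕ → ℕ) : Prop where
  map_mul : ∀ {m n : ℕ}, m.Coprime n → g (m * n) = g m * g n
  le_succ : ∀ {p : ℕ}, p.Prime → g p ≤ p + 1
  le_map_succ : ∀ {p : ℕ}, p.Prime → p ≤ g p + 1
  inj : ∀ {p q : ℕ}, p.Prime → q.Prime → g p = g q → p = q
  pos : ∀ {n : ℕ}, 0 < n → 0 < g n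
  le_sq : ∀ n : ℕ, g n ≤ n ^ 2

/-- `m` is chained at depth `i` above `Y` if there are primes `r₀ ∣ m`, `r₁ ∣ g r₀`, …,
`rᵢ ∣ g rᵢ₋₁` with `rᵢ > Y`. -/
def Chained (g : ℕ → ℕ) (Y : ℕ) : ℕ → ℕ → Prop
  | 0, m => ∃ r : ℕ, r.Prime ∧ r ∣ m ∧ Y < r
  | i + 1, m => ∃ r : ℕ, r.Prime ∧ r ∣ m ∧ Chained g Y i (g r)

theorem isShiftLike_totient : IsShiftLike Nat.totient where
  map_mul h := Nat.totient_mul h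
  le_succ {p} hp := by rw [Nat.totient_prime hp]; omega
  le_map_succ {p} hp := by rw [Nat.totient_prime hp]; omega
  inj {p q} hp hq h := by
    rw [Nat.totient_prime hp, Nat.totient_prime hq] at h
    have := hp.pos
    have := hq.pos
    omega
  pos h := Nat.totient_pos.2 h
  le_sq n := (Nat.totient_le n).trans (Nat.le_self_pow two_ne_zero n)

theorem isShiftLike_sigma : IsShiftLike (fun n : ℕ => ArithmeticFunction.sigma 1 n) := by
  have hprime : ∀ {p : ℕ}, p.Prime → ArithmeticFunction.sigma 1 p = p + 1 := by
    intro p hp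
    simp [ArithmeticFunction.sigma_one_apply, hp.sum_divisors]
  refine ⟨fun h => ArithmeticFunction.isMultiplicative_sigma.map_mul_of_coprime h,
    fun hp => (hprime hp).le, fun hp => ?_, fun hp hq h => ?_, fun {n} hn => ?_, fun n => ?_⟩
  · simp only [hprime hp]; omega
  · simpa [hprime hp, hprime hq] using h
  · simp only [ArithmeticFunction.sigma_one_apply]
    exact Finset.sum_pos (fun d hd => Nat.pos_of_mem_divisors hd) ⟨1, by simp; omega⟩
  · simp only [ArithmeticFunction.sigma_one_apply]
    calc ∑ d ∈ n.divisors, d ≤ ∑ _d ∈ n.divisors, n :=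
          Finset.sum_le_sum fun d hd => Nat.divisor_le hd
      _ = n.divisors.card * n := by simp
      _ ≤ n * n := Nat.mul_le_mul_right _ (Nat.card_divisors_le_self n)
      _ = n ^ 2 := (sq n).symm

theorem IsShiftLike.iterate_pos {g : ℕ → ℕ} (hg : IsShiftLike g) (k : ℕ) {n : ℕ} (hn : 0 < n) :
    0 < g^[k] n := by
  induction k generalizing n with
  | zero => simpa using hn
  | succ k ih => rw [Function.iterate_succ_apply]; exact ih (hg.pos hn)

/-- Two consecutive integers cannot both be prime if the larger exceeds `3`, so `q ≤ g r ≤ r + 1`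
forces `q ≤ r`. Hence every prime of a chain exceeds `Y`, not only the last. -/
theorem lt_of_prime_dvd_map {g : ℕ → ℕ} (hg : IsShiftLike g) {Y q r : ℕ} (hY : 3 ≤ Y)
    (hq : q.Prime) (hr : r.Prime) (h : q ∣ g r) (hqY : Y < q) : Y < r := by
  have h1 := Nat.le_of_dvd (hg.pos hr.pos) h
  have h2 := hg.le_succ hr
  rcases hq.eq_two_or_odd with h3 | h3
  · omega
  rcases hr.eq_two_or_odd with h4 | h4 <;> omega

theorem lt_of_chained_map {g : ℕ → ℕ} (hg : IsShiftLike g) {Y : ℕ} (hY : 3 ≤ Y) {i r : ℕ}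
    (hr : r.Prime) (h : Chained g Y i (g r)) : Y < r := by
  induction i generalizing r with
  | zero =>
    obtain ⟨q, hq, hqr, hqY⟩ := h
    exact lt_of_prime_dvd_map hg hY hq hr hqr hqY
  | succ i ih =>
    obtain ⟨q, hq, hqr, hqc⟩ := h
    exact lt_of_prime_dvd_map hg hY hq hr hqr (ih hq hqc)

theorem card_primeFactors_le {n w : ℕ} (hn : 0 < n) (h : n ≤ 2 ^ w) : n.primeFactors.card ≤ w := by
  have h1 : 2 ^ n.primeFactors.card ≤ ∏ p ∈ n.primeFactors, p :=
    Finset.pow_card_le_prod _ _ _ fun p hp => (Nat.prime_of_mem_primeFactors hp).two_le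
  have h2 := Nat.le_of_dvd hn (Nat.prod_primeFactors_dvd n)
  exact (Nat.pow_le_pow_iff_right (by norm_num)).1 (h1.trans (h2.trans h))

/-! ### Counting chained solutions -/

/-- The descent behind the count: one application of `g` turns the pair `(H, m)` into `(g (s * H), g
r)` and lowers the iterate by one. -/
theorem iterate_succ_mul_prime {g : ℕ → ℕ} (hg : IsShiftLike g) (i : ℕ) {H r s : ℕ}
    (hr : r.Prime) (h : ¬ r ∣ s * H) :
    g^[i + 1] (H * (r * s)) = g^[i] (g (s * H) * g r) := by
  rw [Function.iterate_succ_apply, show H * (r * s) = (s * H) * r by ring,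
    hg.map_mul ((hr.coprime_iff_not_dvd.2 h).symm)]

/-- Counting by the cofactor of a prime divisor. -/
theorem card_le_sum_cofactor {Z : ℕ} (S : Finset ℕ) (R : ℕ → Finset ℕ)
    (h : ∀ m ∈ S, ∃ r s, m = r * s ∧ 0 < s ∧ s ≤ Z ∧ r ∈ R s) :
    S.card ≤ ∑ s ∈ Icc 1 Z, (R s).card := by
  have hsub : S ⊆ (Icc 1 Z).biUnion fun s => (R s).image (· * s) := by
    intro m hm
    obtain ⟨r, s, rfl, hs, hsZ, hr⟩ := h m hm
    exact mem_biUnion.2 ⟨s, mem_Icc.2 ⟨hs, hsZ⟩, mem_image_of_mem _ hr⟩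
  exact (card_le_card hsub).trans (card_biUnion_le.trans
    (sum_le_sum fun s _ => card_image_le))

theorem sum_Icc_inv_le (n : ℕ) {w : ℕ} (hw : 1 ≤ w) (h : n ≤ 2 ^ w) :
    ∑ s ∈ Icc 1 n, (1 : ℝ) / s ≤ 2 * w := by
  have hw' : (1 : ℝ) ≤ w := by exact_mod_cast hw
  have h1 : ∑ s ∈ Icc 1 n, (1 : ℝ) / s = (harmonic n : ℝ) := by
    rw [harmonic_eq_sum_Icc]; simp
  rw [h1]
  rcases Nat.eq_zero_or_pos n with rfl | hn
  · simp
  have h2 : Real.log n ≤ w := by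
    calc Real.log n ≤ Real.log ((2 : ℝ) ^ w) :=
          Real.log_le_log (by exact_mod_cast hn) (by exact_mod_cast h)
      _ = w * Real.log 2 := by rw [Real.log_pow]
      _ ≤ w * 1 := by gcongr; linarith [Real.log_two_lt_d9]
      _ = w := mul_one _
  linarith [harmonic_le_one_add_log n]

/-- Few chained integers solve `A * a(H m) + B * a(H' m) = v`, where `a` is an iterate of `g` and
`v ≠ 0`: if `m = r * s` with `r` the first prime of a chain, then either `r ∣ s * H * H'`, or
`a` factors through `g r`. -/
theorem card_chained_solutions_le {g : ℕ → ℕ} (hg : IsShiftLike g) (i : ℕ) :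
    ∃ C : ℝ, 0 ≤ C ∧ ∀ (Y w X H H' : ℕ) (A B v : ℤ), 3 ≤ Y → 1 ≤ w → X ≤ 2 ^ w →
      0 < H → H ≤ 2 ^ w → 0 < H' → H' ≤ 2 ^ w → v ≠ 0 →
      ((#{m ∈ Icc 1 X | Chained g Y i m ∧
        A * (g^[i + 1] (H * m) : ℤ) + B * (g^[i + 1] (H' * m) : ℤ) = v} : ℕ) : ℝ)
        ≤ C * w ^ (i + 1) * X / Y := by
  -- The exceptional primes, where multiplicativity cannot be used, divide a number at most `2 ^ (3
  -- * w)`.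
  have hexc : ∀ {w X H H' s : ℕ}, X ≤ 2 ^ w → 0 < H → H ≤ 2 ^ w → 0 < H' → H' ≤ 2 ^ w →
      0 < s → s ≤ X → (#(s * H * H').primeFactors : ℕ) ≤ 3 * w := by
    intro w X H H' s hX hH hHw hH' hHw' hs hsX
    refine card_primeFactors_le (by positivity) ?_
    calc s * H * H' ≤ 2 ^ w * 2 ^ w * 2 ^ w := by gcongr; exact hsX.trans hX
      _ = 2 ^ (3 * w) := by ring
  have hdiv : ∀ {H H' r s : ℕ}, r.Prime → 0 < H → 0 < H' → 0 < s →
      r ∉ (s * H * H').primeFactors → ¬ r ∣ s * H ∧ ¬ r ∣ s * H' := by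
    intro H H' r s hr hH hH' hs h
    have h0 : s * H * H' ≠ 0 := by positivity
    have h1 : ¬ r ∣ s * H * H' := fun h2 => h (Nat.mem_primeFactors.2 ⟨hr, h2, h0⟩)
    exact ⟨fun h2 => h1 (h2.mul_right _), fun h2 => h1 (by
      rw [mul_right_comm]; exact h2.mul_right _)⟩
  have hcof : ∀ {X Y r s m : ℕ}, 3 ≤ Y → m ∈ Icc 1 X → m = r * s → Y < r →
      0 < s ∧ s ≤ X / Y ∧ r ≤ X / s := by
    intro X Y r s m hY hm hms hYr
    have hm' := mem_Icc.1 hm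
    have hs : 0 < s := by
      rcases Nat.eq_zero_or_pos s with rfl | h
      · simp at hms; omega
      · exact h
    refine ⟨hs, (Nat.le_div_iff_mul_le (by omega)).2 ?_, (Nat.le_div_iff_mul_le hs).2 ?_⟩
    · calc s * Y ≤ s * r := by gcongr
        _ = m := by rw [hms, mul_comm]
        _ ≤ X := hm'.2
    · rw [← hms]; exact hm'.2
  induction i with
  | zero =>
    -- For each `s` there are at most `3 * w` exceptional primes and one genuine solution, by
    -- injectivity on primes.
    refine ⟨4, by norm_num, ?_⟩
    intro Y w X H H' A B v hY hw hX hH hHw hH' hHw' hv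
    set R : ℕ → Finset ℕ := fun s => (s * H * H').primeFactors ∪
      {r ∈ Icc 1 X | r.Prime ∧ (g r : ℤ) * (A * g (s * H) + B * g (s * H')) = v} with hR
    have hcard : #{m ∈ Icc 1 X | Chained g Y 0 m ∧
        A * (g^[0 + 1] (H * m) : ℤ) + B * (g^[0 + 1] (H' * m) : ℤ) = v} ≤
        ∑ s ∈ Icc 1 (X / Y), (R s).card := by
      refine card_le_sum_cofactor _ R ?_
      intro m hm
      obtain ⟨hmX, ⟨r, hr, ⟨s, hs⟩, hYr⟩, hEq⟩ := mem_filter.1 hm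
      obtain ⟨hs0, hsX, hrX⟩ := hcof hY hmX hs hYr
      refine ⟨r, s, hs, hs0, hsX, ?_⟩
      by_cases hmem : r ∈ (s * H * H').primeFactors
      · exact mem_union_left _ hmem
      refine mem_union_right _ (mem_filter.2 ⟨mem_Icc.2 ⟨hr.pos, hrX.trans (Nat.div_le_self _ _)⟩,
        hr, ?_⟩)
      obtain ⟨h1, h2⟩ := hdiv hr hH hH' hs0 hmem
      rw [hs, iterate_succ_mul_prime hg 0 hr h1, iterate_succ_mul_prime hg 0 hr h2] at hEq
      rw [← hEq]
      simp only [Function.iterate_zero, id_eq]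
      push_cast
      ring
    have hRs : ∀ s ∈ Icc 1 (X / Y), (R s).card ≤ 4 * w := by
      intro s hs
      have hs' := mem_Icc.1 hs
      refine (card_union_le _ _).trans ?_
      have h1 := hexc (s := s) hX hH hHw hH' hHw' hs'.1 (hs'.2.trans (Nat.div_le_self _ _))
      have h2 : #{r ∈ Icc 1 X | r.Prime ∧
          (g r : ℤ) * (A * g (s * H) + B * g (s * H')) = v} ≤ 1 := by
        refine card_le_one.2 fun a ha b hb => ?_
        obtain ⟨_, ha1, ha2⟩ := mem_filter.1 ha
        obtain ⟨_, hb1, hb2⟩ := mem_filter.1 hb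
        refine hg.inj ha1 hb1 ?_
        have h3 : (A * g (s * H) + B * g (s * H') : ℤ) ≠ 0 := by
          intro h3; rw [h3, mul_zero] at ha2; exact hv ha2.symm
        exact_mod_cast mul_right_cancel₀ h3 (ha2.trans hb2.symm)
      omega
    have hY0 : (0 : ℝ) < Y := by exact_mod_cast (show 0 < Y by omega)
    calc ((#{m ∈ Icc 1 X | Chained g Y 0 m ∧
        A * (g^[0 + 1] (H * m) : ℤ) + B * (g^[0 + 1] (H' * m) : ℤ) = v} : ℕ) : ℝ)
        ≤ ((∑ s ∈ Icc 1 (X / Y), 4 * w : ℕ) : ℝ) := by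
          exact_mod_cast hcard.trans (sum_le_sum hRs)
      _ = ((X / Y : ℕ) : ℝ) * (4 * w) := by simp
      _ ≤ (X / Y : ℝ) * (4 * w) := by gcongr; exact Nat.cast_div_le
      _ = 4 * (w : ℝ) ^ (0 + 1) * X / Y := by ring
  | succ i ih =>
    obtain ⟨C, hC, ih⟩ := ih
    -- The `3` comes from the exceptional primes. The factor `4 ^ (i + 2)` is `4 ^ (i + 1)`, from
    -- replacing `w` by `4 * w`, times `2` from `X / s + 1 ≤ 2 * X / s` and `2` from the harmonic
    -- sum.
    refine ⟨3 + 4 ^ (i + 2) * C, by positivity, ?_⟩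
    intro Y w X H H' A B v hY hw hX hH hHw hH' hHw' hv
    have hY0 : (0 : ℝ) < Y := by exact_mod_cast (show 0 < Y by omega)
    have hw1 : (1 : ℝ) ≤ w := by exact_mod_cast hw
    set S : ℕ → Finset ℕ := fun s => {t ∈ Icc 1 (X / s + 1) | Chained g Y i t ∧
      A * (g^[i + 1] (g (s * H) * t) : ℤ) + B * (g^[i + 1] (g (s * H') * t) : ℤ) = v} with hS
    set R : ℕ → Finset ℕ := fun s => (s * H * H').primeFactors ∪
      {r ∈ Icc 1 X | r.Prime ∧ g r ∈ S s} with hR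
    have hcard : #{m ∈ Icc 1 X | Chained g Y (i + 1) m ∧
        A * (g^[i + 1 + 1] (H * m) : ℤ) + B * (g^[i + 1 + 1] (H' * m) : ℤ) = v} ≤
        ∑ s ∈ Icc 1 (X / Y), (R s).card := by
      refine card_le_sum_cofactor _ R ?_
      intro m hm
      obtain ⟨hmX, ⟨r, hr, ⟨s, hs⟩, hrc⟩, hEq⟩ := mem_filter.1 hm
      obtain ⟨hs0, hsX, hrX⟩ := hcof hY hmX hs (lt_of_chained_map hg hY hr hrc)
      refine ⟨r, s, hs, hs0, hsX, ?_⟩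
      by_cases hmem : r ∈ (s * H * H').primeFactors
      · exact mem_union_left _ hmem
      refine mem_union_right _ (mem_filter.2 ⟨mem_Icc.2 ⟨hr.pos, hrX.trans (Nat.div_le_self _ _)⟩,
        hr, mem_filter.2 ⟨mem_Icc.2 ⟨hg.pos hr.pos, (hg.le_succ hr).trans (by omega)⟩, hrc, ?_⟩⟩)
      obtain ⟨h1, h2⟩ := hdiv hr hH hH' hs0 hmem
      rw [hs, iterate_succ_mul_prime hg _ hr h1, iterate_succ_mul_prime hg _ hr h2] at hEq
      exact hEq
    have hRs : ∀ s ∈ Icc 1 (X / Y), ((R s).card : ℝ) ≤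
        3 * w + C * (4 * w) ^ (i + 1) * (2 * X) / Y * (1 / s) := by
      intro s hs
      have hs' := mem_Icc.1 hs
      have hsX : s ≤ X := hs'.2.trans (Nat.div_le_self _ _)
      have hs0 : (0 : ℝ) < s := by exact_mod_cast hs'.1
      have h1 := hexc (s := s) hX hH hHw hH' hHw' hs'.1 hsX
      have h2 : #{r ∈ Icc 1 X | r.Prime ∧ g r ∈ S s} ≤ (S s).card := by
        refine card_le_card_of_injOn g (fun r hr => (mem_filter.1 hr).2.2) ?_
        intro a ha b hb hab
        exact hg.inj (mem_filter.1 ha).2.1 (mem_filter.1 hb).2.1 hab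
      have hpow : ∀ {H : ℕ}, H ≤ 2 ^ w → g (s * H) ≤ 2 ^ (4 * w) := by
        intro H hH
        calc g (s * H) ≤ (s * H) ^ 2 := hg.le_sq _
          _ ≤ (2 ^ w * 2 ^ w) ^ 2 := by gcongr; exact hsX.trans hX
          _ = 2 ^ (4 * w) := by ring
      have hXs : X / s + 1 ≤ 2 ^ (4 * w) := by
        calc X / s + 1 ≤ 2 ^ w + 2 ^ w :=
              add_le_add ((Nat.div_le_self _ _).trans hX) Nat.one_le_two_pow
          _ = 2 ^ (w + 1) := by ring
          _ ≤ 2 ^ (4 * w) := Nat.pow_le_pow_right (by norm_num) (by omega)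
      -- The new multipliers `g (s * H)` are at most `(2 ^ w * 2 ^ w) ^ 2`, hence the length `4 *
      -- w`.
      have h3 := ih Y (4 * w) (X / s + 1) (g (s * H)) (g (s * H')) A B v hY (by omega) hXs
        (hg.pos (Nat.mul_pos hs'.1 hH)) (hpow hHw) (hg.pos (Nat.mul_pos hs'.1 hH')) (hpow hHw') hv
      have h4 : ((X / s + 1 : ℕ) : ℝ) ≤ 2 * X / s := by
        have h5 : 1 ≤ X / s := (Nat.one_le_div_iff hs'.1).2 hsX
        have h6 : ((X / s : ℕ) : ℝ) ≤ X / s := Nat.cast_div_le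
        have h7 : (1 : ℝ) ≤ ((X / s : ℕ) : ℝ) := by exact_mod_cast h5
        push_cast
        rw [mul_div_assoc]
        linarith
      have h5 : ((R s).card : ℝ) ≤ (3 * w : ℕ) + ((S s).card : ℝ) := by
        exact_mod_cast (card_union_le _ _).trans (add_le_add h1 h2)
      calc ((R s).card : ℝ) ≤ (3 * w : ℕ) + ((S s).card : ℝ) := h5
        _ ≤ (3 * w : ℕ) + C * ((4 * w : ℕ) : ℝ) ^ (i + 1) * ((X / s + 1 : ℕ) : ℝ) / Y := by
          gcongr
        _ ≤ (3 * w : ℕ) + C * ((4 * w : ℕ) : ℝ) ^ (i + 1) * (2 * X / s) / Y := by gcongr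
        _ = _ := by push_cast; ring
    have hXY : ((X / Y : ℕ) : ℝ) ≤ X / Y := Nat.cast_div_le
    calc ((#{m ∈ Icc 1 X | Chained g Y (i + 1) m ∧
        A * (g^[i + 1 + 1] (H * m) : ℤ) + B * (g^[i + 1 + 1] (H' * m) : ℤ) = v} : ℕ) : ℝ)
        ≤ ∑ s ∈ Icc 1 (X / Y), ((R s).card : ℝ) := by exact_mod_cast hcard
      _ ≤ ∑ s ∈ Icc 1 (X / Y), (3 * w + C * (4 * w) ^ (i + 1) * (2 * X) / Y * (1 / s)) :=
          sum_le_sum hRs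
      _ = ((X / Y : ℕ) : ℝ) * (3 * w) +
          C * (4 * w) ^ (i + 1) * (2 * X) / Y * ∑ s ∈ Icc 1 (X / Y), (1 : ℝ) / s := by
          rw [sum_add_distrib, mul_sum, sum_const, nsmul_eq_mul, Nat.card_Icc, Nat.add_sub_cancel]
      _ ≤ (X / Y : ℝ) * (3 * w) + C * (4 * w) ^ (i + 1) * (2 * X) / Y * (2 * w) := by
          gcongr
          exact sum_Icc_inv_le _ hw ((Nat.div_le_self _ _).trans hX)
      _ = 3 * w * (X / Y) + 4 ^ (i + 2) * C * w ^ (i + 2) * (X / Y) := by ring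
      _ ≤ 3 * w ^ (i + 2) * (X / Y) + 4 ^ (i + 2) * C * w ^ (i + 2) * (X / Y) := by
          gcongr
          exact le_self_pow₀ hw1 (by omega)
      _ = (3 + 4 ^ (i + 2) * C) * w ^ (i + 1 + 1) * X / Y := by ring

/-! ### Smooth numbers -/

/-- The completely multiplicative function `n ↦ n ^ (-s)`. -/
noncomputable def rpowNegHom (s : ℝ) : ℕ →* ℝ where
  toFun n := (n : ℝ) ^ (-s)
  map_one' := by simp
  map_mul' m n := by
    push_cast
    exact Real.mul_rpow (Nat.cast_nonneg m) (Nat.cast_nonneg n)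

theorem inv_one_sub_le_exp {t : ℝ} (h : t ≤ 3 / 4) (h0 : 0 ≤ t) :
    (1 - t)⁻¹ ≤ Real.exp (4 * t) := by
  have h1 : 0 < 1 - t := by linarith
  have h2 := Real.one_sub_inv_le_log_of_pos h1
  have h3 : (1 - t)⁻¹ - 1 ≤ 4 * t := by
    have : (1 - t)⁻¹ - 1 = t * (1 - t)⁻¹ := by field_simp; ring
    rw [this]
    have h4 : (1 - t)⁻¹ ≤ 4 := by
      rw [inv_le_comm₀ h1 (by norm_num)]; linarith
    nlinarith
  calc (1 - t)⁻¹ = Real.exp (Real.log (1 - t)⁻¹) := (Real.exp_log (by positivity)).symm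
    _ ≤ Real.exp (4 * t) := by
      rw [Real.log_inv]
      exact Real.exp_le_exp.2 (by linarith)

/-- Rankin's bound for smooth numbers. -/
theorem card_smooth_le_exp {V w : ℕ} (hV : 2 ≤ V) :
    ((#{m ∈ Icc 1 (2 ^ w) | ∀ p : ℕ, p.Prime → p ∣ m → p ≤ 2 ^ V} : ℕ) : ℝ) ≤
      2 ^ w * Real.exp (16 * V - (w : ℝ) / V / 2) := by
  -- With this Rankin exponent `p ^ (1 / V) ≤ 2` for all `p ≤ 2 ^ V`, so `p ^ (-s) ≤ 2 / p` and the
  -- Euler product is at most `exp (16 * V)`.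
  set s : ℝ := 1 - 1 / V with hs
  have hV' : (2 : ℝ) ≤ V := by exact_mod_cast hV
  have hVinv : (1 : ℝ) / V ≤ 1 / 2 := by gcongr
  have hVpos : (0 : ℝ) < 1 / V := by positivity
  set f := rpowNegHom s with hf
  have hfapp : ∀ n : ℕ, f n = (n : ℝ) ^ (-s) := fun n => rfl
  have hfnn : ∀ n : ℕ, 0 ≤ f n := fun n => Real.rpow_nonneg (Nat.cast_nonneg n) _
  have hfp34 : ∀ {p : ℕ}, p.Prime → f p ≤ 3 / 4 := by
    intro p hp
    have hp2 : (2 : ℝ) ≤ p := by exact_mod_cast hp.two_le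
    calc f p = (p : ℝ) ^ (-s) := rfl
      _ ≤ (2 : ℝ) ^ (-s) := Real.rpow_le_rpow_of_nonpos (by norm_num) hp2 (by linarith)
      _ ≤ (2 : ℝ) ^ (-(1 / 2) : ℝ) :=
        Real.rpow_le_rpow_of_exponent_le (by norm_num) (by linarith)
      _ ≤ 3 / 4 := by
        rw [Real.rpow_neg (by norm_num), ← Real.sqrt_eq_rpow, inv_le_comm₀ (by positivity)
          (by norm_num)]
        exact Real.le_sqrt_of_sq_le (by norm_num)
  have hfp : ∀ {p : ℕ}, p.Prime → p ≤ 2 ^ V → f p ≤ 2 / p := by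
    intro p hp hpV
    have hp0 : (0 : ℝ) < p := by exact_mod_cast hp.pos
    have h1 : (p : ℝ) ^ (1 / V : ℝ) ≤ 2 := by
      calc (p : ℝ) ^ (1 / V : ℝ) ≤ ((2 : ℝ) ^ V) ^ (1 / V : ℝ) :=
            Real.rpow_le_rpow hp0.le (by exact_mod_cast hpV) hVpos.le
        _ = 2 := by
          rw [one_div]; exact Real.pow_rpow_inv_natCast (by norm_num) (by omega)
    calc f p = (p : ℝ) ^ (-1 + 1 / V : ℝ) := by rw [hfapp, hs]; congr 1; ring
      _ = (p : ℝ)⁻¹ * (p : ℝ) ^ (1 / V : ℝ) := by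
        rw [Real.rpow_add hp0, Real.rpow_neg_one]
      _ ≤ (p : ℝ)⁻¹ * 2 := by gcongr
      _ = 2 / p := by ring
  set N := 2 ^ V + 1 with hN
  obtain ⟨-, hsum⟩ := EulerProduct.summable_and_hasSum_smoothNumbers_prod_primesBelow_geometric
    (f := f) (fun {p} hp => by
      rw [Real.norm_of_nonneg (hfnn p)]; linarith [hfp34 hp]) N
  have hprod : ∏ p ∈ N.primesBelow, (1 - f p)⁻¹ ≤ Real.exp (16 * V) := by
    have hmem : ∀ p ∈ N.primesBelow, p.Prime ∧ p ≤ 2 ^ V := fun p hp =>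
      ⟨Nat.prime_of_mem_primesBelow hp, by have := Nat.lt_of_mem_primesBelow hp; omega⟩
    calc ∏ p ∈ N.primesBelow, (1 - f p)⁻¹ ≤ ∏ p ∈ N.primesBelow, Real.exp (8 * (1 / p)) := by
          refine prod_le_prod (fun p hp => ?_) fun p hp => ?_
          · have := hfp34 (hmem p hp).1
            exact inv_nonneg.2 (by linarith)
          · refine (inv_one_sub_le_exp (hfp34 (hmem p hp).1) (hfnn p)).trans ?_
            have h1 := hfp (hmem p hp).1 (hmem p hp).2
            have h2 : (8 : ℝ) * (1 / p) = 4 * (2 / p) := by ring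
            rw [h2]
            exact Real.exp_le_exp.2 (by linarith)
      _ = Real.exp (8 * ∑ p ∈ N.primesBelow, (1 : ℝ) / p) := by rw [← Real.exp_sum, mul_sum]
      _ ≤ Real.exp (8 * (2 * V)) := by
          refine Real.exp_le_exp.2 (mul_le_mul_of_nonneg_left ?_ (by norm_num))
          refine le_trans ?_ (sum_Icc_inv_le (2 ^ V) (by omega) le_rfl)
          refine sum_le_sum_of_subset_of_nonneg ?_ fun _ _ _ => by positivity
          intro p hp
          exact mem_Icc.2 ⟨(hmem p hp).1.pos, (hmem p hp).2⟩
      _ = Real.exp (16 * V) := by congr 1; ring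
  set S : Finset ℕ := {m ∈ Icc 1 (2 ^ w) | ∀ p : ℕ, p.Prime → p ∣ m → p ≤ 2 ^ V} with hS
  have hSs : ∀ m ∈ S, m ∈ N.smoothNumbers := by
    intro m hm
    refine Nat.mem_smoothNumbers'.2 fun p hp hpm => ?_
    have := (mem_filter.1 hm).2 p hp hpm
    omega
  have hSsum : ∑ m ∈ S, f m ≤ Real.exp (16 * V) := by
    refine le_trans ?_ hprod
    rw [← sum_subtype_of_mem (fun m => f m) hSs]
    exact sum_le_hasSum _ (fun m _ => hfnn m) hsum
  have hX : ((2 : ℝ) ^ w) ^ s ≤ 2 ^ w * Real.exp (-((w : ℝ) / V / 2)) := by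
    have h1 : ((2 : ℝ) ^ w) ^ s = 2 ^ w * (2 : ℝ) ^ (-((w : ℝ) / V)) := by
      rw [← Real.rpow_natCast, ← Real.rpow_mul (by norm_num), ← Real.rpow_add (by norm_num)]
      congr 1
      rw [hs]; ring
    rw [h1]
    gcongr
    rw [Real.rpow_def_of_pos (by norm_num)]
    refine Real.exp_le_exp.2 ?_
    have h2 : 0 ≤ (w : ℝ) / V := by positivity
    nlinarith [Real.log_two_gt_d9]
  calc (S.card : ℝ) = ∑ m ∈ S, (1 : ℝ) := by simp
    _ ≤ ∑ m ∈ S, ((2 : ℝ) ^ w) ^ s * f m := by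
      refine sum_le_sum fun m hm => ?_
      obtain ⟨h1, h2⟩ := mem_Icc.1 (mem_filter.1 hm).1
      have hm0 : (0 : ℝ) < m := by exact_mod_cast h1
      rw [hfapp, Real.rpow_neg hm0.le, ← div_eq_mul_inv, one_le_div (by positivity)]
      exact Real.rpow_le_rpow hm0.le (by exact_mod_cast h2) (by linarith)
    _ = ((2 : ℝ) ^ w) ^ s * ∑ m ∈ S, f m := by rw [mul_sum]
    _ ≤ (2 ^ w * Real.exp (-((w : ℝ) / V / 2))) * Real.exp (16 * V) := by
      have := sum_nonneg fun m (_ : m ∈ S) => hfnn m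
      gcongr
    _ = 2 ^ w * Real.exp (16 * V - (w : ℝ) / V / 2) := by
      rw [mul_assoc, ← Real.exp_add]; congr 2; ring

/-- With `u = w / V ≥ V ^ 2`, the term `16 * V` is at most `256 + u / 4`, and the remaining `exp
(-(u / 4))` beats `u ^ (2 * A) ≥ w ^ A`. -/
theorem card_smooth_le (A : ℕ) : ∃ C : ℝ, 0 ≤ C ∧ ∀ V w : ℕ, 2 ≤ V → V ^ 3 ≤ w →
    ((#{m ∈ Icc 1 (2 ^ w) | ∀ p : ℕ, p.Prime → p ∣ m → p ≤ 2 ^ V} : ℕ) : ℝ) ≤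
      C * 2 ^ w / w ^ A := by
  refine ⟨Real.exp 256 * 4 ^ (2 * A) * (2 * A).factorial, by positivity, fun V w hV hw => ?_⟩
  refine (card_smooth_le_exp hV).trans ?_
  have hV' : (2 : ℝ) ≤ V := by exact_mod_cast hV
  have hw' : (V : ℝ) ^ 3 ≤ w := by exact_mod_cast hw
  have hw0 : (0 : ℝ) < w := lt_of_lt_of_le (by positivity) hw'
  set u : ℝ := w / V with hu
  have hwu : (w : ℝ) = u * V := by rw [hu]; field_simp
  have huV : (V : ℝ) ^ 2 ≤ u := by
    rw [hu, le_div_iff₀ (by positivity)]; linarith [pow_succ (V : ℝ) 2]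
  have hu0 : 0 ≤ u := by positivity
  have h1 : Real.exp (16 * V - u / 2) ≤ Real.exp 256 * Real.exp (-(u / 4)) := by
    rw [← Real.exp_add]
    refine Real.exp_le_exp.2 ?_
    nlinarith [sq_nonneg ((V : ℝ) / 2 - 16)]
  have h2 : (w : ℝ) ^ A ≤ 4 ^ (2 * A) * (2 * A).factorial * Real.exp (u / 4) := by
    have h3 := Real.pow_div_factorial_le_exp (u / 4) (by positivity) (2 * A)
    rw [div_le_iff₀ (by positivity)] at h3
    calc (w : ℝ) ^ A ≤ (u * u) ^ A := by
          gcongr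
          rw [hwu]
          gcongr
          nlinarith
      _ = 4 ^ (2 * A) * (u / 4) ^ (2 * A) := by
          rw [← mul_pow, pow_mul]; congr 1; ring
      _ ≤ 4 ^ (2 * A) * (Real.exp (u / 4) * (2 * A).factorial) := by gcongr
      _ = _ := by ring
  rw [le_div_iff₀ (by positivity)]
  calc 2 ^ w * Real.exp (16 * V - u / 2) * (w : ℝ) ^ A
      ≤ 2 ^ w * (Real.exp 256 * Real.exp (-(u / 4))) *
        (4 ^ (2 * A) * (2 * A).factorial * Real.exp (u / 4)) := by gcongr
    _ = Real.exp 256 * 4 ^ (2 * A) * (2 * A).factorial * 2 ^ w *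
        (Real.exp (-(u / 4)) * Real.exp (u / 4)) := by ring
    _ = _ := by rw [← Real.exp_add]; simp

/-! ### Scarcity of integers that are not chained -/

/-- Dyadic summation: each block `[2 ^ j, 2 ^ (j + 1))` with `j ≥ t` contributes at most `2 * C / t
^ A`. -/
theorem sum_inv_le_of_card_le {P : ℕ → Prop} [DecidablePred P] {C : ℝ} (hC : 0 ≤ C) {A t : ℕ} (ht : 1 ≤ t)
    (h : ∀ j, t ≤ j → ((#{n ∈ Icc 1 (2 ^ j) | P n} : ℕ) : ℝ) ≤ C * 2 ^ j / j ^ A) (u : ℕ) :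
    ∑ n ∈ Ico (2 ^ t) (2 ^ u) with P n, (1 : ℝ) / n ≤ u * (2 * C / t ^ A) := by
  induction u with
  | zero =>
    have : Ico (2 ^ t) (2 ^ 0) = (∅ : Finset ℕ) :=
      Ico_eq_empty (by have := Nat.one_le_two_pow (n := t); simp)
    rw [this]; simp
  | succ u ih =>
    rcases lt_or_ge u t with hut | hut
    · rw [Ico_eq_empty (by
        rw [not_lt]; exact Nat.pow_le_pow_right (by norm_num) (by omega))]
      simp only [filter_empty, sum_empty]
      positivity
    have ht0 : (0 : ℝ) < t := by exact_mod_cast ht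
    have hsplit : Ico (2 ^ t) (2 ^ (u + 1)) = Ico (2 ^ t) (2 ^ u) ∪ Ico (2 ^ u) (2 ^ (u + 1)) :=
      (Ico_union_Ico_eq_Ico (Nat.pow_le_pow_right (by norm_num) hut)
        (Nat.pow_le_pow_right (by norm_num) (by omega))).symm
    have hdisj : Disjoint (Ico (2 ^ t) (2 ^ u)) (Ico (2 ^ u) (2 ^ (u + 1))) :=
      Ico_disjoint_Ico_consecutive _ _ _
    have hblock : ∑ n ∈ Ico (2 ^ u) (2 ^ (u + 1)) with P n, (1 : ℝ) / n ≤ 2 * C / t ^ A := by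
      calc ∑ n ∈ Ico (2 ^ u) (2 ^ (u + 1)) with P n, (1 : ℝ) / n
          ≤ ∑ n ∈ Ico (2 ^ u) (2 ^ (u + 1)) with P n, (1 : ℝ) / 2 ^ u := by
            refine sum_le_sum fun n hn => ?_
            have h1 : 2 ^ u ≤ n := (mem_Ico.1 (mem_filter.1 hn).1).1
            have h2 : (2 : ℝ) ^ u ≤ n := by exact_mod_cast h1
            gcongr
        _ = #{n ∈ Ico (2 ^ u) (2 ^ (u + 1)) | P n} * ((1 : ℝ) / 2 ^ u) := by
            rw [sum_const, nsmul_eq_mul]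
        _ ≤ #{n ∈ Icc 1 (2 ^ (u + 1)) | P n} * ((1 : ℝ) / 2 ^ u) := by
            gcongr
            intro n hn
            have h1 := mem_Ico.1 hn
            have h2 := Nat.one_le_two_pow (n := u)
            exact mem_Icc.2 ⟨by omega, by omega⟩
        _ ≤ (C * 2 ^ (u + 1) / ((u + 1 : ℕ) : ℝ) ^ A) * ((1 : ℝ) / 2 ^ u) := by
            gcongr
            exact h (u + 1) (by omega)
        _ = 2 * C / ((u + 1 : ℕ) : ℝ) ^ A := by
            rw [pow_succ]; field_simp
        _ ≤ 2 * C / t ^ A := by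
            gcongr
            omega
    rw [hsplit, filter_union, sum_union (disjoint_filter_filter hdisj)]
    push_cast
    linarith

/-- Almost every integer is chained. -/
theorem card_not_chained_le {g : ℕ → ℕ} (hg : IsShiftLike g) (i : ℕ) :
    ∀ A : ℕ, ∃ (K : ℕ) (C : ℝ), 1 ≤ K ∧ 0 ≤ C ∧ ∀ V w : ℕ, 2 ≤ V → V ^ K ≤ w →
      ((#{m ∈ Icc 1 (2 ^ w) | ¬ Chained g (2 ^ V) i m} : ℕ) : ℝ) ≤ C * 2 ^ w / w ^ A := by
  induction i with
  | zero =>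
    intro A
    obtain ⟨C, hC, h⟩ := card_smooth_le A
    refine ⟨3, C, by norm_num, hC, fun V w hV hw => le_trans ?_ (h V w hV hw)⟩
    gcongr with m
    intro hm p hp hpm
    by_contra hlt
    exact hm ⟨p, hp, hpm, not_le.1 hlt⟩
  | succ i ih =>
    intro A
    -- Below, `t` is the integer cube root of `w`: small enough for the smooth bound, large enough
    -- for the inductive one. The exponent `3 * (A + 1)` turns `t` back into `w ^ (A + 1)`, and one
    -- power of `w` pays for the number of dyadic blocks.
    obtain ⟨K, C₁, hK, hC₁, h₁⟩ := ih (3 * (A + 1))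
    obtain ⟨C₀, hC₀, h₀⟩ := card_smooth_le A
    refine ⟨3 * K, C₀ + 2 * (4 * C₁ * 8 ^ (A + 1)), by omega, by positivity, fun V w hV hw => ?_⟩
    obtain ⟨t, htw, htw'⟩ : ∃ t : ℕ, t ^ 3 ≤ w ∧ w < (t + 1) ^ 3 := by
      have hex : ∃ n : ℕ, w < (n + 1) ^ 3 :=
        ⟨w, by nlinarith [Nat.zero_le w, sq_nonneg w, Nat.zero_le (w ^ 3)]⟩
      refine ⟨Nat.find hex, ?_, Nat.find_spec hex⟩
      rcases Nat.eq_zero_or_pos (Nat.find hex) with h | h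
      · rw [h]; omega
      · have := Nat.find_min hex (m := Nat.find hex - 1) (by omega)
        rwa [Nat.sub_add_cancel h, not_lt] at this
    have hVt : V ^ K ≤ t := by
      have h1 : (V ^ K) ^ 3 < (t + 1) ^ 3 := by
        rw [← pow_mul, mul_comm K 3]; exact lt_of_le_of_lt hw htw'
      have := lt_of_pow_lt_pow_left₀ 3 (by omega) h1
      omega
    have ht2 : 2 ≤ t := hV.trans ((Nat.le_self_pow (by omega) V).trans hVt)
    have hw1 : 1 ≤ w := le_trans (Nat.one_le_pow _ _ (by omega)) htw
    have hw0 : (0 : ℝ) < w := by exact_mod_cast hw1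
    have hw1' : (1 : ℝ) ≤ w := by exact_mod_cast hw1
    have ht0 : (0 : ℝ) < t := by exact_mod_cast (show 0 < t by omega)
    obtain ⟨P, hP⟩ : ∃ P : ℕ → Prop, ∀ n, P n ↔ ¬ Chained g (2 ^ V) i n := ⟨_, fun _ => Iff.rfl⟩
    have h₁' : ∀ j, t ≤ j → ((#{n ∈ Icc 1 (2 ^ j) | P n} : ℕ) : ℝ) ≤
        C₁ * 2 ^ j / j ^ (3 * (A + 1)) := by
      intro j hj
      have h2 : ({n ∈ Icc 1 (2 ^ j) | P n} : Finset ℕ) =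
          {n ∈ Icc 1 (2 ^ j) | ¬ Chained g (2 ^ V) i n} := by
        ext n; simp only [mem_filter, hP]
      rw [h2]
      exact h₁ V j hV (hVt.trans hj)
    have hsum : ∑ n ∈ Ico (2 ^ t) (2 ^ (w + 1)) with P n, (1 : ℝ) / n ≤
        4 * C₁ * 8 ^ (A + 1) / w ^ A := by
      refine (sum_inv_le_of_card_le hC₁ (by omega) h₁' (w + 1)).trans ?_
      have h2 : (w : ℝ) ^ (A + 1) ≤ 8 ^ (A + 1) * t ^ (3 * (A + 1)) := by
        rw [pow_mul, ← mul_pow]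
        gcongr
        have h3 : w ≤ 8 * t ^ 3 := by
          calc w ≤ (t + 1) ^ 3 := htw'.le
            _ ≤ (2 * t) ^ 3 := by gcongr; omega
            _ = 8 * t ^ 3 := by ring
        exact_mod_cast h3
      rw [le_div_iff₀ (by positivity), mul_div_assoc', div_mul_eq_mul_div,
        div_le_iff₀ (by positivity)]
      push_cast
      calc ((w : ℝ) + 1) * (2 * C₁) * w ^ A ≤ (w + w) * (2 * C₁) * w ^ A := by gcongr
        _ = 4 * C₁ * w ^ (A + 1) := by ring
        _ ≤ 4 * C₁ * (8 ^ (A + 1) * t ^ (3 * (A + 1))) := by gcongr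
        _ = _ := by ring
    -- An integer that is not chained is either `2 ^ t`-smooth or a multiple of some `r ∈ R`. As `g`
    -- is injective on primes and `g r ≤ 2 * r`, the reciprocal sum over `R` is at most twice the
    -- one over the values `g r`, which are not chained at the lower depth.
    set R : Finset ℕ := {r ∈ Icc 1 (2 ^ w) | r.Prime ∧ 2 ^ t < r ∧ P (g r)} with hR
    have hRsum : ∑ r ∈ R, (1 : ℝ) / r ≤ 2 * (4 * C₁ * 8 ^ (A + 1) / w ^ A) := by
      have hinj : Set.InjOn g R := fun a ha b hb hab =>
        hg.inj (mem_filter.1 ha).2.1 (mem_filter.1 hb).2.1 hab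
      calc ∑ r ∈ R, (1 : ℝ) / r ≤ ∑ r ∈ R, 2 * ((1 : ℝ) / (g r)) := by
            refine sum_le_sum fun r hr => ?_
            have hrp := (mem_filter.1 hr).2.1
            have h3 : (0 : ℝ) < r := by exact_mod_cast hrp.pos
            have h4 : (0 : ℝ) < g r := by exact_mod_cast hg.pos hrp.pos
            have h5 : g r ≤ 2 * r := (hg.le_succ hrp).trans (by have := hrp.pos; omega)
            have h6 : (g r : ℝ) ≤ 2 * r := by exact_mod_cast h5
            rw [mul_one_div, div_le_div_iff₀ h3 h4]
            linarith
        _ = 2 * ∑ n ∈ R.image g, (1 : ℝ) / n := by rw [← mul_sum, sum_image hinj]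
        _ ≤ 2 * ∑ n ∈ Ico (2 ^ t) (2 ^ (w + 1)) with P n, (1 : ℝ) / n := by
            gcongr
            intro n hn
            obtain ⟨r, hr, rfl⟩ := mem_image.1 hn
            obtain ⟨hr1, hrp, hrt, hrP⟩ := mem_filter.1 hr
            have h3 := hg.le_succ hrp
            have h4 := hg.le_map_succ hrp
            have h5 := (mem_Icc.1 hr1).2
            have h6 : 2 ^ (w + 1) = 2 ^ w + 2 ^ w := by ring
            have h7 : 2 ^ 1 ≤ 2 ^ w := Nat.pow_le_pow_right (by norm_num) hw1
            exact mem_filter.2 ⟨mem_Ico.2 ⟨by omega, by omega⟩, hrP⟩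
        _ ≤ _ := by gcongr
    have hsub : ({m ∈ Icc 1 (2 ^ w) | ¬ Chained g (2 ^ V) (i + 1) m} : Finset ℕ) ⊆
        {m ∈ Icc 1 (2 ^ w) | ∀ p : ℕ, p.Prime → p ∣ m → p ≤ 2 ^ t} ∪
          R.biUnion fun r => {m ∈ Ioc 0 (2 ^ w) | r ∣ m} := by
      intro m hm
      obtain ⟨hm1, hm2⟩ := mem_filter.1 hm
      by_cases hsm : ∀ p : ℕ, p.Prime → p ∣ m → p ≤ 2 ^ t
      · exact mem_union_left _ (mem_filter.2 ⟨hm1, hsm⟩)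
      · push Not at hsm
        obtain ⟨p, hp, hpm, hpt⟩ := hsm
        have hm' := mem_Icc.1 hm1
        refine mem_union_right _ (mem_biUnion.2 ⟨p, mem_filter.2 ⟨mem_Icc.2 ⟨hp.pos,
          (Nat.le_of_dvd hm'.1 hpm).trans hm'.2⟩, hp, hpt,
          (hP _).2 fun h => hm2 ⟨p, hp, hpm, h⟩⟩,
          mem_filter.2 ⟨mem_Ioc.2 hm', hpm⟩⟩)
    calc ((#{m ∈ Icc 1 (2 ^ w) | ¬ Chained g (2 ^ V) (i + 1) m} : ℕ) : ℝ)
        ≤ ((#{m ∈ Icc 1 (2 ^ w) | ∀ p : ℕ, p.Prime → p ∣ m → p ≤ 2 ^ t} : ℕ) : ℝ) +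
          ∑ r ∈ R, (((2 ^ w / r : ℕ) : ℕ) : ℝ) := by
          have h3 := (card_le_card hsub).trans (card_union_le _ _)
          have h4 : (R.biUnion fun r => {m ∈ Ioc 0 (2 ^ w) | r ∣ m}).card ≤
              ∑ r ∈ R, 2 ^ w / r :=
            card_biUnion_le.trans (sum_le_sum fun r _ => (Nat.Ioc_filter_dvd_card_eq_div _ _).le)
          exact_mod_cast h3.trans (Nat.add_le_add_left h4 _)
      _ ≤ C₀ * 2 ^ w / w ^ A + ∑ r ∈ R, 2 ^ w * ((1 : ℝ) / r) := by
          refine add_le_add (h₀ t w ht2 htw) (sum_le_sum fun r _ => ?_)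
          refine Nat.cast_div_le.trans (le_of_eq ?_)
          push_cast; ring
      _ ≤ C₀ * 2 ^ w / w ^ A + 2 ^ w * (2 * (4 * C₁ * 8 ^ (A + 1) / w ^ A)) := by
          rw [← mul_sum]; gcongr
      _ = (C₀ + 2 * (4 * C₁ * 8 ^ (A + 1))) * 2 ^ w / w ^ A := by ring

/-! ### Reciprocal sums over primes and chained primes -/

/-- Chebyshev's bounds suffice at ratio `16`: the main terms leave `(16 - 2) * log 2 > 9.6` times
`16 ^ j`, and for `j ≥ 2` the errors cost at most `8 * 16 ^ j`. -/
theorem theta_block_ge {j : ℕ} (hj : 2 ≤ j) :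
    (16 : ℝ) ^ j ≤ ∑ p ∈ Ico (16 ^ j : ℕ) (16 ^ (j + 1)) with p.Prime, Real.log p := by
  have hsum : ∑ p ∈ Ico (16 ^ j : ℕ) (16 ^ (j + 1)) with p.Prime, Real.log p =
      Chebyshev.theta ((16 ^ (j + 1) : ℕ) : ℝ) - Chebyshev.theta ((16 ^ j : ℕ) : ℝ) := by
    -- The half-open intervals defining `theta` and the block differ only at powers of `16`, which
    -- are not prime.
    have hnp : ∀ {k p : ℕ}, 2 ≤ k → p.Prime → p ≠ 16 ^ k := by
      rintro k p hk hp rfl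
      exact Nat.Prime.not_prime_pow hk hp
    rw [eq_sub_iff_add_eq', Chebyshev.theta, Chebyshev.theta, Nat.floor_natCast,
      Nat.floor_natCast, ← sum_union]
    · refine sum_congr ?_ fun _ _ => rfl
      ext p
      have h1 : 16 ^ j ≤ 16 ^ (j + 1) := Nat.pow_le_pow_right (by norm_num) (by omega)
      simp only [mem_union, mem_filter, mem_Ioc, mem_Ico]
      constructor
      · rintro (⟨h, hp⟩ | ⟨h, hp⟩)
        · exact ⟨by omega, hp⟩
        · exact ⟨⟨hp.pos, by omega⟩, hp⟩
      · rintro ⟨h, hp⟩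
        have h2 := hnp hj hp
        have h3 := hnp (k := j + 1) (by omega) hp
        rcases le_or_gt p (16 ^ j) with h4 | h4
        · exact Or.inl ⟨⟨h.1, h4⟩, hp⟩
        · exact Or.inr ⟨⟨h4.le, by omega⟩, hp⟩
    · rw [disjoint_left]
      intro p hp hp'
      simp only [mem_filter, mem_Ioc, mem_Ico] at hp hp'
      exact hnp hj hp.2 (by omega)
  rw [hsum]
  have h1 := Chebyshev.theta_ge (16 ^ (j + 1))
  have h2 := Chebyshev.theta_le_log4_mul_x (x := ((16 ^ j : ℕ) : ℝ)) (by positivity)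
  have hl4 : Real.log 4 = 2 * Real.log 2 := by
    rw [show (4 : ℝ) = 2 ^ 2 by norm_num, Real.log_pow]; norm_num
  have hl16 : Real.log ((16 ^ (j + 1) : ℕ) : ℝ) = 4 * (j + 1) * Real.log 2 := by
    push_cast
    rw [Real.log_pow, show (16 : ℝ) = 2 ^ 4 by norm_num, Real.log_pow]; push_cast; ring
  have hsq : √((16 ^ (j + 1) : ℕ) : ℝ) = 4 * 4 ^ j := by
    have : ((16 ^ (j + 1) : ℕ) : ℝ) = (4 * 4 ^ j) ^ 2 := by
      push_cast
      rw [mul_pow, ← pow_mul, mul_comm j 2, pow_mul]; norm_num; ring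
    rw [this, Real.sqrt_sq (by positivity)]
  have hlog1 : Real.log (((16 ^ (j + 1) : ℕ) : ℝ) + 1) ≤ 4 * (j + 1) * Real.log 2 + 1 := by
    have hn : (1 : ℝ) ≤ ((16 ^ (j + 1) : ℕ) : ℝ) := by exact_mod_cast Nat.one_le_pow _ _ (by norm_num)
    calc Real.log (((16 ^ (j + 1) : ℕ) : ℝ) + 1) ≤ Real.log (((16 ^ (j + 1) : ℕ) : ℝ) * 2) :=
          Real.log_le_log (by positivity) (by linarith)
      _ = Real.log ((16 ^ (j + 1) : ℕ) : ℝ) + Real.log 2 :=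
          Real.log_mul (by positivity) (by norm_num)
      _ ≤ _ := by rw [hl16]; linarith [Real.log_two_lt_d9]
  have hpow : ∀ k : ℕ, 2 ≤ k → 30 * ((k : ℝ) + 1) ≤ 8 * 4 ^ k := by
    intro k hk
    induction k, hk using Nat.le_induction with
    | base => norm_num
    | succ k hk ih =>
      push_cast
      rw [pow_succ]
      have : (0 : ℝ) ≤ k := Nat.cast_nonneg k
      linarith
  have h3 := hpow j hj
  rw [hl16, hsq] at h1
  rw [hl4] at h2
  have h4 : (16 : ℝ) ^ j = 4 ^ j * 4 ^ j := by rw [← mul_pow]; norm_num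
  have h5 : (1 : ℝ) ≤ 4 ^ j := one_le_pow₀ (by norm_num)
  have hl2 := Real.log_two_gt_d9
  have hl2' := Real.log_two_lt_d9
  push_cast at h1 h2 hlog1 ⊢
  rw [pow_succ] at h1 hlog1 ⊢
  have hj0 : (0 : ℝ) ≤ j := Nat.cast_nonneg j
  set q : ℝ := 4 ^ j with hq
  have h6 : 30 * ((j : ℝ) + 1) * q ≤ 8 * (q * q) := by nlinarith
  have h7 : 4 * ((j : ℝ) + 1) * Real.log 2 + 1 ≤ 4 * (j + 1) * q := by
    have : (1 : ℝ) ≤ (j + 1) := by linarith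
    have h8 : ((j : ℝ) + 1) * Real.log 2 ≤ (j + 1) * (3 / 4) := by gcongr; linarith
    nlinarith
  have h9 : 2 * (4 * q) * (4 * ((j : ℝ) + 1) * Real.log 2) ≤ 24 * (j + 1) * q := by
    have h8 : ((j : ℝ) + 1) * Real.log 2 ≤ (j + 1) * (3 / 4) := by gcongr; linarith
    nlinarith
  have h10 : 14 * (69 / 100) * (16 : ℝ) ^ j ≤ 14 * Real.log 2 * 16 ^ j := by
    gcongr; linarith
  rw [← h4] at h6
  have h11 : 0 ≤ ((j : ℝ) + 1) * q := by positivity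
  have h12 : (0 : ℝ) ≤ 16 ^ j := by positivity
  linarith

/-- In the block `log p ≤ 3 * (j + 1)` and `1 ≤ 16 ^ (j + 1) / p`; hence `48 = 3 * 16`. -/
theorem sum_prime_inv_block_ge {j : ℕ} (hj : 2 ≤ j) :
    1 / (48 * ((j : ℝ) + 1)) ≤ ∑ p ∈ Ico (16 ^ j : ℕ) (16 ^ (j + 1)) with p.Prime, (1 : ℝ) / p := by
  have h := theta_block_ge hj
  have h1 : ∀ p ∈ ({p ∈ Ico (16 ^ j : ℕ) (16 ^ (j + 1)) | p.Prime} : Finset ℕ),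
      Real.log p ≤ 3 * ((j : ℝ) + 1) * 16 ^ (j + 1) * (1 / p) := by
    intro p hp
    obtain ⟨hp1, hp2⟩ := mem_filter.1 hp
    have hp0 : (0 : ℝ) < p := by exact_mod_cast hp2.pos
    have hp3 : (p : ℝ) ≤ 16 ^ (j + 1) := by exact_mod_cast (mem_Ico.1 hp1).2.le
    have hl : Real.log p ≤ 3 * ((j : ℝ) + 1) := by
      calc Real.log p ≤ Real.log (16 ^ (j + 1)) := Real.log_le_log hp0 hp3
        _ = ((j : ℝ) + 1) * (4 * Real.log 2) := by
          rw [Real.log_pow, show (16 : ℝ) = 2 ^ 4 by norm_num, Real.log_pow]; push_cast; ring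
        _ ≤ ((j : ℝ) + 1) * 3 := by gcongr; linarith [Real.log_two_lt_d9]
        _ = _ := by ring
    have h2 : 1 ≤ (16 : ℝ) ^ (j + 1) * (1 / p) := by
      rw [mul_one_div, one_le_div hp0]; exact hp3
    calc Real.log p ≤ 3 * ((j : ℝ) + 1) * 1 := by linarith
      _ ≤ 3 * ((j : ℝ) + 1) * (16 ^ (j + 1) * (1 / p)) := by gcongr
      _ = _ := by ring
  have h2 := h.trans (sum_le_sum h1)
  rw [← mul_sum, pow_succ] at h2
  rw [div_le_iff₀ (by positivity)]
  have h3 : (0 : ℝ) < 16 ^ j := by positivity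
  refine le_of_mul_le_mul_left ?_ h3
  linarith

theorem sum_prime_inv_ge {a b : ℕ} (ha : 2 ≤ a) (hab : a ≤ b) :
    Real.log (((b : ℝ) + 1) / (a + 1)) / 48 ≤
      ∑ p ∈ Ico (16 ^ a : ℕ) (16 ^ b) with p.Prime, (1 : ℝ) / p := by
  induction b, hab using Nat.le_induction with
  | base => rw [div_self (by positivity)]; simp
  | succ b hab ih =>
    have hsplit : Ico (16 ^ a) (16 ^ (b + 1)) =
        Ico (16 ^ a) (16 ^ b) ∪ Ico (16 ^ b) (16 ^ (b + 1)) :=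
      (Ico_union_Ico_eq_Ico (Nat.pow_le_pow_right (by norm_num) hab)
        (Nat.pow_le_pow_right (by norm_num) (by omega))).symm
    rw [hsplit, filter_union, sum_union (disjoint_filter_filter
      (Ico_disjoint_Ico_consecutive _ _ _))]
    have h1 := sum_prime_inv_block_ge (j := b) (by omega)
    have h2 : Real.log (((b + 1 : ℕ) + 1 : ℝ) / (a + 1)) =
        Real.log (((b : ℝ) + 1) / (a + 1)) + Real.log (1 + 1 / ((b : ℝ) + 1)) := by
      rw [← Real.log_mul (by positivity) (by positivity)]
      congr 1
      push_cast
      field_simp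
    have h3 : Real.log (1 + 1 / ((b : ℝ) + 1)) ≤ 1 / (b + 1) := by
      have := Real.log_le_sub_one_of_pos (x := 1 + 1 / ((b : ℝ) + 1)) (by positivity)
      linarith
    have h4 : 1 / (48 * ((b : ℝ) + 1)) = 1 / (b + 1) / 48 := by field_simp
    rw [h2]
    linarith

/-- The chained primes in `[16 ^ a, 16 ^ b)`. -/
noncomputable def chainedPrimes (g : ℕ → ℕ) (Y i a b : ℕ) : Finset ℕ :=
  {p ∈ Ico (16 ^ a : ℕ) (16 ^ b) | p.Prime ∧ Chained g Y i p}

/-- Integers that are not chained have dyadic density `O(1 / j ^ 2)`. The range has at most `4 * b ≤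
4 * a ^ 2` dyadic blocks, all with `j ≥ 4 * a`, so removing those integers costs `O(1)` in the
reciprocal sum. -/
theorem sum_chainedPrimes_inv_ge {g : ℕ → ℕ} (hg : IsShiftLike g) (i : ℕ) :
    ∃ (K : ℕ) (C : ℝ), ∀ V a b : ℕ, 2 ≤ V → 2 ≤ a → V ^ K ≤ a → a ≤ b → b ≤ a ^ 2 →
      Real.log (((b : ℝ) + 1) / (a + 1)) / 48 - C ≤
        ∑ p ∈ chainedPrimes g (2 ^ V) i a b, (1 : ℝ) / p := by
  obtain ⟨K, C, hK, hC, h⟩ := card_not_chained_le hg i 2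
  refine ⟨K, C, fun V a b hV ha hVa hab hba => ?_⟩
  have h1 := sum_prime_inv_ge ha hab
  have h2 := sum_inv_le_of_card_le (P := fun n => ¬ Chained g (2 ^ V) i n) hC (t := 4 * a) (by omega)
    (fun j hj => h V j hV (hVa.trans (by omega))) (4 * b)
  have ha0 : (0 : ℝ) < a := by exact_mod_cast (show 0 < a by omega)
  have hba' : (b : ℝ) ≤ a ^ 2 := by exact_mod_cast hba
  have h3 : ((4 * b : ℕ) : ℝ) * (2 * C / ((4 * a : ℕ) : ℝ) ^ 2) ≤ C := by
    push_cast
    rw [mul_div_assoc', div_le_iff₀ (by positivity)]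
    have : 4 * (b : ℝ) * (2 * C) ≤ 4 * a ^ 2 * (2 * C) := by gcongr
    nlinarith [mul_nonneg hC (sq_nonneg (a : ℝ))]
  have hpow : ∀ n : ℕ, 2 ^ (4 * n) = 16 ^ n := fun n => by rw [pow_mul]; norm_num
  rw [hpow, hpow] at h2
  have h4 : ∑ p ∈ Ico (16 ^ a : ℕ) (16 ^ b) with p.Prime, (1 : ℝ) / p ≤
      ∑ p ∈ chainedPrimes g (2 ^ V) i a b, (1 : ℝ) / p +
        ∑ p ∈ Ico (16 ^ a : ℕ) (16 ^ b) with ¬ Chained g (2 ^ V) i p, (1 : ℝ) / p := by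
    refine le_trans (sum_le_sum_of_subset_of_nonneg
      (t := chainedPrimes g (2 ^ V) i a b ∪
        {p ∈ Ico (16 ^ a : ℕ) (16 ^ b) | ¬ Chained g (2 ^ V) i p}) ?_ fun _ _ _ => by positivity) ?_
    · intro p hp
      obtain ⟨hp1, hp2⟩ := mem_filter.1 hp
      by_cases hc : Chained g (2 ^ V) i p
      · exact mem_union_left _ (mem_filter.2 ⟨hp1, hp2, hc⟩)
      · exact mem_union_right _ (mem_filter.2 ⟨hp1, hc⟩)
    · rw [← sum_union_inter]
      exact le_add_of_nonneg_right (sum_nonneg fun _ _ => by positivity)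
  linarith

/-! ### The Turán–Kubilius inequality and bilinear sums -/

theorem card_filter_dvd_Icc (N d : ℕ) : #{n ∈ Icc 1 N | d ∣ n} = N / d := by
  rw [← Nat.Ioc_filter_dvd_card_eq_div]
  rfl

/-- The Turán–Kubilius inequality for a finite set of primes. -/
theorem sum_sq_card_dvd_sub_le {N : ℕ} (P : Finset ℕ) (hP : ∀ p ∈ P, p.Prime)
    (hcard : P.card ≤ N) :
    ∑ n ∈ Icc 1 N, ((∑ p ∈ P, if p ∣ n then (1 : ℝ) else 0) - ∑ p ∈ P, (1 : ℝ) / p) ^ 2 ≤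
      3 * N * ∑ p ∈ P, (1 : ℝ) / p := by
  set L := ∑ p ∈ P, (1 : ℝ) / p with hL
  set ω : ℕ → ℝ := fun n => ∑ p ∈ P, if p ∣ n then (1 : ℝ) else 0 with hω
  have hL0 : 0 ≤ L := sum_nonneg fun _ _ => by positivity
  have h1 : N * L - P.card ≤ ∑ n ∈ Icc 1 N, ω n := by
    rw [hω, sum_comm, hL, mul_sum, card_eq_sum_ones, Nat.cast_sum, ← sum_sub_distrib]
    refine sum_le_sum fun p hp => ?_
    rw [sum_boole, card_filter_dvd_Icc, mul_one_div]
    have := Nat.lt_floor_add_one ((N : ℝ) / p)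
    rw [Nat.floor_div_eq_div] at this
    push_cast
    linarith
  have h2 : ∑ n ∈ Icc 1 N, ω n ^ 2 ≤ N * L ^ 2 + N * L := by
    have h3 : ∀ n, ω n ^ 2 = ∑ p ∈ P, ∑ q ∈ P, if p ∣ n ∧ q ∣ n then (1 : ℝ) else 0 := by
      intro n
      rw [hω, sq, sum_mul_sum]
      refine sum_congr rfl fun p _ => sum_congr rfl fun q _ => ?_
      by_cases hp : p ∣ n <;> by_cases hq : q ∣ n <;> simp [hp, hq]
    have h4 : ∀ p ∈ P, ∀ q ∈ P, ∑ n ∈ Icc 1 N, (if p ∣ n ∧ q ∣ n then (1 : ℝ) else 0) ≤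
        N * (1 / p * (1 / q)) + if p = q then N * ((1 : ℝ) / p) else 0 := by
      intro p hp q hq
      rw [sum_boole]
      split_ifs with hpq
      · subst hpq
        simp only [and_self]
        rw [card_filter_dvd_Icc]
        have h5 : ((N / p : ℕ) : ℝ) ≤ N / p := Nat.cast_div_le
        have h6 : 0 ≤ (N : ℝ) * (1 / p * (1 / p)) := by positivity
        have h7 : (N : ℝ) * (1 / p) = N / p := mul_one_div _ _
        linarith
      · have h5 : ∀ n, p ∣ n ∧ q ∣ n ↔ p * q ∣ n := fun n =>
          ⟨fun h => ((Nat.coprime_primes (hP p hp) (hP q hq)).2 hpq).mul_dvd_of_dvd_of_dvd h.1 h.2,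
            fun h => ⟨(dvd_mul_right p q).trans h, (dvd_mul_left q p).trans h⟩⟩
        simp only [h5]
        rw [card_filter_dvd_Icc, add_zero]
        refine Nat.cast_div_le.trans (le_of_eq ?_)
        push_cast
        rw [one_div_mul_one_div, mul_one_div]
    calc ∑ n ∈ Icc 1 N, ω n ^ 2
        = ∑ p ∈ P, ∑ q ∈ P, ∑ n ∈ Icc 1 N, (if p ∣ n ∧ q ∣ n then (1 : ℝ) else 0) := by
          simp only [h3]
          rw [sum_comm]
          exact sum_congr rfl fun p _ => sum_comm
      _ ≤ ∑ p ∈ P, ∑ q ∈ P,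
          (N * (1 / p * (1 / q)) + if p = q then N * ((1 : ℝ) / p) else 0) :=
          sum_le_sum fun p hp => sum_le_sum fun q hq => h4 p hp q hq
      _ = N * L ^ 2 + N * L := by
          simp only [sum_add_distrib]
          congr 1
          · rw [sq, hL, sum_mul_sum, mul_sum]
            exact sum_congr rfl fun p _ => (mul_sum _ _ _).symm
          · rw [hL, mul_sum]
            refine sum_congr rfl fun p hp => ?_
            rw [sum_ite_eq, if_pos hp]
  have h3 : ∑ n ∈ Icc 1 N, (ω n - L) ^ 2 =
      ∑ n ∈ Icc 1 N, ω n ^ 2 - 2 * L * ∑ n ∈ Icc 1 N, ω n + N * L ^ 2 := by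
    have : ∀ n, (ω n - L) ^ 2 = ω n ^ 2 - 2 * L * ω n + L ^ 2 := fun n => by ring
    simp only [this, sum_add_distrib, sum_sub_distrib, ← mul_sum]
    simp
  have h4 : (P.card : ℝ) ≤ N := by exact_mod_cast hcard
  -- Expanding the square leaves at most `N * L + 2 * L * #P`, and `#P ≤ N`.
  rw [h3]
  nlinarith

theorem sum_multiples {N p : ℕ} (hp : 0 < p) (F : ℕ → ℂ) :
    ∑ m ∈ Icc 1 (N / p), F (p * m) = ∑ n ∈ Icc 1 N with p ∣ n, F n := by
  refine sum_bij (fun m _ => p * m) ?_ ?_ ?_ ?_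
  · intro m hm
    obtain ⟨h1, h2⟩ := mem_Icc.1 hm
    refine mem_filter.2 ⟨mem_Icc.2 ⟨Nat.mul_pos hp h1, ?_⟩, dvd_mul_right _ _⟩
    rw [mul_comm]
    exact (Nat.le_div_iff_mul_le hp).1 h2
  · intro m _ m' _ h
    exact Nat.eq_of_mul_eq_mul_left hp h
  · rintro n hn
    obtain ⟨hn1, ⟨m, rfl⟩⟩ := mem_filter.1 hn
    obtain ⟨h1, h2⟩ := mem_Icc.1 hn1
    refine ⟨m, mem_Icc.2 ⟨Nat.pos_of_mul_pos_left h1, ?_⟩, rfl⟩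
    rw [Nat.le_div_iff_mul_le hp, mul_comm]
    exact h2
  · intro m _
    rfl

/-- The double sum counts `F n` with weight `ω n`, the number of `p ∈ P` dividing `n`.
Cauchy–Schwarz and Turán–Kubilius bound the cost of replacing this weight by its mean. -/
theorem norm_sum_inv_mul_sum_sub_le {N : ℕ} (P : Finset ℕ) (hP : ∀ p ∈ P, p.Prime)
    (hcard : P.card ≤ N) (F : ℕ → ℂ) (hF : ∀ n ∈ Icc 1 N, ‖F n‖ ≤ 1) :
    ‖((∑ p ∈ P, (1 : ℝ) / p : ℝ) : ℂ) * ∑ n ∈ Icc 1 N, F n -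
        ∑ p ∈ P, ∑ m ∈ Icc 1 (N / p), F (p * m)‖ ≤
      N * √(3 * ∑ p ∈ P, (1 : ℝ) / p) := by
  have htk := sum_sq_card_dvd_sub_le P hP hcard
  set L := ∑ p ∈ P, (1 : ℝ) / p with hL
  set ω : ℕ → ℝ := fun n => ∑ p ∈ P, if p ∣ n then (1 : ℝ) else 0 with hω
  have h1 : ∑ p ∈ P, ∑ m ∈ Icc 1 (N / p), F (p * m) = ∑ n ∈ Icc 1 N, (ω n : ℂ) * F n := by
    rw [sum_congr rfl fun p hp => sum_multiples (hP p hp).pos F]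
    simp only [sum_filter]
    rw [sum_comm]
    refine sum_congr rfl fun n _ => ?_
    rw [hω]
    push_cast
    rw [sum_mul]
    exact sum_congr rfl fun p _ => by split_ifs <;> simp
  rw [h1, mul_sum, ← sum_sub_distrib]
  have h2 : ‖∑ n ∈ Icc 1 N, ((L : ℂ) * F n - (ω n : ℂ) * F n)‖ ≤ ∑ n ∈ Icc 1 N, |ω n - L| := by
    refine norm_sum_le_of_le _ fun n hn => ?_
    rw [← sub_mul, norm_mul, ← Complex.ofReal_sub, Complex.norm_real, Real.norm_eq_abs, abs_sub_comm]
    exact mul_le_of_le_one_right (abs_nonneg _) (hF n hn)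
  refine h2.trans ?_
  have h3 : (∑ n ∈ Icc 1 N, |ω n - L|) ^ 2 ≤ N * (3 * N * L) := by
    refine sq_sum_le_card_mul_sum_sq.trans ?_
    simp only [sq_abs, Nat.card_Icc, Nat.add_sub_cancel]
    gcongr
  refine (Real.le_sqrt_of_sq_le h3).trans (le_of_eq ?_)
  rw [show (N : ℝ) * (3 * N * L) = N ^ 2 * (3 * L) by ring, Real.sqrt_mul (by positivity),
    Real.sqrt_sq (by positivity)]

/-- Bilinear sums with bounded coefficients are controlled by the correlations of the kernel. -/
theorem norm_bilinear_pow_four_le (S T : Finset ℕ) (K : ℕ → ℕ → ℂ) (u v : ℕ → ℂ)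
    (hu : ∀ m ∈ T, ‖u m‖ ≤ 1) (hv : ∀ p ∈ S, ‖v p‖ ≤ 1) :
    ‖∑ p ∈ S, ∑ m ∈ T, v p * u m * K p m‖ ^ 4 ≤
      ((S.card : ℝ) * T.card) ^ 2 *
        ∑ p ∈ S, ∑ q ∈ S, ‖∑ m ∈ T, K p m * conj (K q m)‖ ^ 2 := by
  set G : ℕ → ℂ := fun m => ∑ p ∈ S, v p * K p m with hG
  set c : ℕ → ℕ → ℂ := fun p q => ∑ m ∈ T, K p m * conj (K q m) with hc
  have h1 : ‖∑ p ∈ S, ∑ m ∈ T, v p * u m * K p m‖ ≤ ∑ m ∈ T, ‖G m‖ := by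
    rw [sum_comm]
    refine norm_sum_le_of_le _ fun m hm => ?_
    have : ∑ p ∈ S, v p * u m * K p m = u m * G m := by
      rw [hG, mul_sum]; exact sum_congr rfl fun p _ => by ring
    rw [this, norm_mul]
    exact mul_le_of_le_one_left (norm_nonneg _) (hu m hm)
  have h2 : ∑ m ∈ T, ‖G m‖ ^ 2 ≤ ∑ p ∈ S, ∑ q ∈ S, ‖c p q‖ := by
    have h3 : ((∑ m ∈ T, ‖G m‖ ^ 2 : ℝ) : ℂ) = ∑ p ∈ S, ∑ q ∈ S, v p * conj (v q) * c p q := by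
      push_cast
      have h4 : ∀ m, ((‖G m‖ : ℂ)) ^ 2 =
          ∑ p ∈ S, ∑ q ∈ S, v p * conj (v q) * (K p m * conj (K q m)) := by
        intro m
        rw [← Complex.mul_conj', hG, map_sum, sum_mul_sum]
        refine sum_congr rfl fun p _ => sum_congr rfl fun q _ => ?_
        rw [map_mul]; ring
      simp only [h4]
      rw [sum_comm]
      refine sum_congr rfl fun p _ => ?_
      rw [sum_comm]
      exact sum_congr rfl fun q _ => (mul_sum _ _ _).symm
    have h5 : ∑ m ∈ T, ‖G m‖ ^ 2 = ‖((∑ m ∈ T, ‖G m‖ ^ 2 : ℝ) : ℂ)‖ := by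
      rw [Complex.norm_real, Real.norm_of_nonneg (sum_nonneg fun _ _ => by positivity)]
    rw [h5, h3]
    refine norm_sum_le_of_le _ fun p hp => norm_sum_le_of_le _ fun q hq => ?_
    rw [norm_mul, norm_mul, RCLike.norm_conj]
    exact mul_le_of_le_one_left (norm_nonneg _)
      (mul_le_one₀ (hv p hp) (norm_nonneg _) (hv q hq))
  -- A second Cauchy–Schwarz, over pairs `(p, q)`, makes the correlations appear squared, ready for
  -- Parseval.
  have h6 : (∑ p ∈ S, ∑ q ∈ S, ‖c p q‖) ^ 2 ≤
      (S.card : ℝ) ^ 2 * ∑ p ∈ S, ∑ q ∈ S, ‖c p q‖ ^ 2 := by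
    rw [← sum_product' S S fun p q => ‖c p q‖, ← sum_product' S S fun p q => ‖c p q‖ ^ 2]
    refine sq_sum_le_card_mul_sum_sq.trans (le_of_eq ?_)
    rw [card_product]; push_cast; ring
  have h7 : ‖∑ p ∈ S, ∑ m ∈ T, v p * u m * K p m‖ ^ 2 ≤
      T.card * ∑ p ∈ S, ∑ q ∈ S, ‖c p q‖ := by
    calc ‖∑ p ∈ S, ∑ m ∈ T, v p * u m * K p m‖ ^ 2 ≤ (∑ m ∈ T, ‖G m‖) ^ 2 := by gcongr
      _ ≤ T.card * ∑ m ∈ T, ‖G m‖ ^ 2 := sq_sum_le_card_mul_sum_sq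
      _ ≤ _ := by gcongr
  calc ‖∑ p ∈ S, ∑ m ∈ T, v p * u m * K p m‖ ^ 4
      = (‖∑ p ∈ S, ∑ m ∈ T, v p * u m * K p m‖ ^ 2) ^ 2 := by ring
    _ ≤ (T.card * ∑ p ∈ S, ∑ q ∈ S, ‖c p q‖) ^ 2 := by gcongr
    _ = (T.card : ℝ) ^ 2 * (∑ p ∈ S, ∑ q ∈ S, ‖c p q‖) ^ 2 := by ring
    _ ≤ (T.card : ℝ) ^ 2 * ((S.card : ℝ) ^ 2 * ∑ p ∈ S, ∑ q ∈ S, ‖c p q‖ ^ 2) := by gcongr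
    _ = _ := by ring

/-! ### From the twisted mean to correlations -/

theorem sum_chainedPrimes_eq {M : Type*} [AddCommMonoid M] (g : ℕ → ℕ) (Y i : ℕ) {a b : ℕ}
    (hab : a ≤ b) (h : ℕ → M) :
    ∑ p ∈ chainedPrimes g Y i a b, h p =
      ∑ j ∈ Ico a b, ∑ p ∈ chainedPrimes g Y i j (j + 1), h p := by
  induction b, hab using Nat.le_induction with
  | base => simp [chainedPrimes]
  | succ b hab ih =>
    rw [sum_Ico_succ_top hab, ← ih]
    simp only [chainedPrimes]
    rw [← Ico_union_Ico_eq_Ico (Nat.pow_le_pow_right (by norm_num) hab)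
        (Nat.pow_le_pow_right (by norm_num) (by omega)), filter_union,
      sum_union (disjoint_filter_filter (Ico_disjoint_Ico_consecutive _ _ _))]

/-- The kernel of the bilinear sum attached to `g^[i + 1]`. -/
noncomputable def kernel (g : ℕ → ℕ) (Y i N : ℕ) (α : ℝ) (p m : ℕ) : ℂ :=
  if p * m ≤ N ∧ ¬ p ∣ m ∧ Chained g Y i m then e (α * (g^[i + 1] (p * m) : ℝ)) else 0

/-- The total correlation of the kernel over the block of chained primes in
`[16 ^ j, 16 ^ (j + 1))`. -/
noncomputable def correlation (g : ℕ → ℕ) (Y i N j : ℕ) (α : ℝ) : ℝ :=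
  ∑ p ∈ chainedPrimes g Y i j (j + 1), ∑ q ∈ chainedPrimes g Y i j (j + 1),
    ‖∑ m ∈ Icc 1 (N / 16 ^ j), kernel g Y i N α p m * conj (kernel g Y i N α q m)‖ ^ 2

/-- The condition `p * m ≤ N` inside `kernel` lets all primes of a block share one range of `m`. The
two sums then differ only where `p ∣ m` or `m` is not chained. -/
theorem norm_kernel_sum_sub_le {g : ℕ → ℕ} {Y i N j p : ℕ} {α : ℝ} {f : ArithmeticFunction ℂ}
    (hf : f ∈ M₁) (hp : p ∈ chainedPrimes g Y i j (j + 1)) :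
    ‖∑ m ∈ Icc 1 (N / p), f (p * m) * e (α * (g^[i + 1] (p * m) : ℝ)) -
        ∑ m ∈ Icc 1 (N / 16 ^ j), f p * f m * kernel g Y i N α p m‖ ≤
      #{m ∈ Icc 1 (N / p) | p ∣ m} + #{m ∈ Icc 1 (N / p) | ¬ Chained g Y i m} := by
  obtain ⟨hp1, hpp, -⟩ := mem_filter.1 hp
  have hpj := (mem_Ico.1 hp1).1
  have hsub : Icc 1 (N / p) ⊆ Icc 1 (N / 16 ^ j) :=
    Icc_subset_Icc_right (Nat.div_le_div_left hpj (by positivity))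
  have hle : ∀ m, m ≤ N / p ↔ p * m ≤ N := fun m => by
    rw [Nat.le_div_iff_mul_le hpp.pos, mul_comm]
  rw [← sum_subset hsub fun m hm hm' => ?_, ← sum_sub_distrib]
  · rw [card_filter, card_filter]
    push_cast
    rw [← sum_add_distrib]
    refine norm_sum_le_of_le _ fun m hm => ?_
    obtain ⟨hm1, hm2⟩ := mem_Icc.1 hm
    have hm3 := (hle m).1 hm2
    have hone : ‖f (p * m) * e (α * (g^[i + 1] (p * m) : ℝ))‖ = 1 := by
      rw [norm_mul, norm_e, mul_one, hf.2 _ (Nat.mul_pos hpp.pos hm1)]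
    by_cases h1 : p ∣ m
    · have h2 : kernel g Y i N α p m = 0 := if_neg fun h => h.2.1 h1
      rw [h2, mul_zero, sub_zero, hone, if_pos h1]
      split_ifs <;> norm_num
    · by_cases h3 : Chained g Y i m
      · have h2 : kernel g Y i N α p m = e (α * (g^[i + 1] (p * m) : ℝ)) :=
          if_pos ⟨hm3, h1, h3⟩
        rw [h2, hf.1.map_mul_of_coprime ((hpp.coprime_iff_not_dvd).2 h1), sub_self, norm_zero]
        positivity
      · have h2 : kernel g Y i N α p m = 0 := if_neg fun h => h3 h.2.2
        rw [h2, mul_zero, sub_zero, hone, if_neg h1, if_pos h3]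
        norm_num
  · have h2 : kernel g Y i N α p m = 0 := if_neg fun h => hm' (mem_Icc.2
      ⟨(mem_Icc.1 hm).1, (hle m).2 h.1⟩)
    rw [h2, mul_zero]

theorem card_chainedPrimes_le (g : ℕ → ℕ) (Y i a b : ℕ) :
    (chainedPrimes g Y i a b).card ≤ 16 ^ b := by
  refine (card_filter_le _ _).trans ?_
  rw [Nat.card_Ico]
  exact Nat.sub_le _ _

/-- The mean value of `f(n) e(α a(n))` is bounded by the correlations of the kernel, uniformly
in `f`. -/
theorem norm_twisted_sum_le {g : ℕ → ℕ} {Y i N a b : ℕ} {α ε η : ℝ} {f : ArithmeticFunction ℂ}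
    (hf : f ∈ M₁) (hab : a ≤ b) (hb : 16 ^ b ≤ N) (hη : 0 ≤ η)
    (hU : ∀ p ∈ chainedPrimes g Y i a b,
      ((#{m ∈ Icc 1 (N / p) | ¬ Chained g Y i m} : ℕ) : ℝ) ≤ ε * (N / p))
    (hQ : ∀ j ∈ Ico a b, 256 * correlation g Y i N j α ≤ η ^ 4 * N ^ 2) :
    (∑ p ∈ chainedPrimes g Y i a b, (1 : ℝ) / p) *
        ‖∑ n ∈ Icc 1 N, f n * e (α * (g^[i + 1] n : ℝ))‖ ≤
      N * (√(3 * ∑ p ∈ chainedPrimes g Y i a b, (1 : ℝ) / p) +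
        (1 / 16 ^ a + ε) * ∑ p ∈ chainedPrimes g Y i a b, (1 : ℝ) / p + b * η) := by
  set P := chainedPrimes g Y i a b with hPdef
  set L := ∑ p ∈ P, (1 : ℝ) / p with hL
  set F : ℕ → ℂ := fun n => f n * e (α * (g^[i + 1] n : ℝ)) with hF
  have hL0 : 0 ≤ L := sum_nonneg fun _ _ => by positivity
  have hP : ∀ p ∈ P, p.Prime := fun p hp => (mem_filter.1 hp).2.1
  have hF1 : ∀ n ∈ Icc 1 N, ‖F n‖ ≤ 1 := by
    intro n hn
    rw [hF, norm_mul, norm_e, mul_one, hf.2 _ (mem_Icc.1 hn).1]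
  have h1 := norm_sum_inv_mul_sum_sub_le P hP ((card_chainedPrimes_le _ _ _ _ _).trans hb) F hF1
  set B : ℕ → ℂ := fun j => ∑ p ∈ chainedPrimes g Y i j (j + 1), ∑ m ∈ Icc 1 (N / 16 ^ j),
    f p * f m * kernel g Y i N α p m with hB
  have h2 : ‖∑ p ∈ P, ∑ m ∈ Icc 1 (N / p), F (p * m) - ∑ j ∈ Ico a b, B j‖ ≤
      N * ((1 / 16 ^ a + ε) * L) := by
    have hN : (N : ℝ) * ((1 / 16 ^ a + ε) * L) = ∑ p ∈ P, (1 / 16 ^ a + ε) * (N / p) := by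
      rw [hL, mul_sum, mul_sum]
      exact sum_congr rfl fun p _ => by ring
    rw [hN, hPdef, sum_chainedPrimes_eq g Y i hab, sum_chainedPrimes_eq g Y i hab,
      ← sum_sub_distrib]
    refine norm_sum_le_of_le _ fun j hj => ?_
    rw [hB, ← sum_sub_distrib]
    refine norm_sum_le_of_le _ fun p hp => ?_
    refine (norm_kernel_sum_sub_le hf hp).trans ?_
    obtain ⟨hp1, hpp, hpc⟩ := mem_filter.1 hp
    obtain ⟨hp2, hp3⟩ := mem_Ico.1 hp1
    have hj' := mem_Ico.1 hj
    have hap : 16 ^ a ≤ p := (Nat.pow_le_pow_right (by norm_num) hj'.1).trans hp2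
    have hpP : p ∈ P := mem_filter.2 ⟨mem_Ico.2 ⟨hap,
      hp3.trans_le (Nat.pow_le_pow_right (by norm_num) hj'.2)⟩, hpp, hpc⟩
    have h3 := hU p hpP
    have hap' : (16 : ℝ) ^ a ≤ p := by exact_mod_cast hap
    have hp0 : (0 : ℝ) < p := by exact_mod_cast hpp.pos
    have h4 : ((#{m ∈ Icc 1 (N / p) | p ∣ m} : ℕ) : ℝ) ≤ 1 / 16 ^ a * (N / p) := by
      rw [card_filter_dvd_Icc]
      calc ((N / p / p : ℕ) : ℝ) ≤ ((N / p : ℕ) : ℝ) / p := Nat.cast_div_le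
        _ ≤ (N / p : ℝ) / p := by gcongr; exact Nat.cast_div_le
        _ = 1 / p * (N / p) := by ring
        _ ≤ 1 / 16 ^ a * (N / p) := by gcongr
    linarith
  have h3 : ∀ j ∈ Ico a b, ‖B j‖ ≤ η * N := by
    intro j hj
    have h4 := norm_bilinear_pow_four_le (chainedPrimes g Y i j (j + 1)) (Icc 1 (N / 16 ^ j))
      (kernel g Y i N α) f f (fun m hm => (hf.2 m (mem_Icc.1 hm).1).le)
      (fun p hp => (hf.2 p (mem_filter.1 hp).2.1.pos).le)
    -- A block has at most `16 ^ (j + 1)` primes against `N / 16 ^ j` values of `m`. The square of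
    -- this `16` is the `256` in `hQ`.
    have h5 : ((chainedPrimes g Y i j (j + 1)).card : ℝ) * (Icc 1 (N / 16 ^ j)).card ≤ 16 * N := by
      rw [Nat.card_Icc, Nat.add_sub_cancel]
      have : (chainedPrimes g Y i j (j + 1)).card * (N / 16 ^ j) ≤ 16 * N := by
        calc (chainedPrimes g Y i j (j + 1)).card * (N / 16 ^ j)
            ≤ 16 ^ (j + 1) * (N / 16 ^ j) := by gcongr; exact card_chainedPrimes_le _ _ _ _ _
          _ = 16 * (16 ^ j * (N / 16 ^ j)) := by ring
          _ ≤ 16 * N := by gcongr; exact Nat.mul_div_le _ _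
      exact_mod_cast this
    refine le_of_pow_le_pow_left₀ (n := 4) (by norm_num) (by positivity) (h4.trans ?_)
    have hc : 0 ≤ correlation g Y i N j α :=
      sum_nonneg fun _ _ => sum_nonneg fun _ _ => by positivity
    calc _ ≤ (16 * (N : ℝ)) ^ 2 * correlation g Y i N j α := by
          unfold correlation at hc ⊢; gcongr
      _ = N ^ 2 * (256 * correlation g Y i N j α) := by ring
      _ ≤ N ^ 2 * (η ^ 4 * N ^ 2) :=
          mul_le_mul_of_nonneg_left (hQ j hj) (by positivity)
      _ = (η * N) ^ 4 := by ring
  have h4 : ‖∑ j ∈ Ico a b, B j‖ ≤ b * (η * N) := by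
    refine (norm_sum_le_of_le _ h3).trans ?_
    rw [sum_const, Nat.card_Ico, nsmul_eq_mul]
    gcongr
    exact Nat.sub_le _ _
  have h5 : L * ‖∑ n ∈ Icc 1 N, F n‖ = ‖(L : ℂ) * ∑ n ∈ Icc 1 N, F n‖ := by
    rw [norm_mul, Complex.norm_real, Real.norm_of_nonneg hL0]
  rw [h5]
  have h6 : (L : ℂ) * ∑ n ∈ Icc 1 N, F n =
      ((L : ℂ) * ∑ n ∈ Icc 1 N, F n - ∑ p ∈ P, ∑ m ∈ Icc 1 (N / p), F (p * m)) +
      (∑ p ∈ P, ∑ m ∈ Icc 1 (N / p), F (p * m) - ∑ j ∈ Ico a b, B j) + ∑ j ∈ Ico a b, B j := by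
    ring
  rw [h6]
  refine (norm_add₃_le).trans ?_
  linarith

/-! ### Mean square of the correlations over `α` -/

theorem e_add (x y : ℝ) : e (x + y) = e x * e y := by
  rw [e, e, e, ← Complex.exp_add]; congr 1; push_cast; ring

theorem conj_e (x : ℝ) : conj (e x) = e (-x) := by
  rw [e, e, ← Complex.exp_conj]; congr 1; simp [Complex.conj_ofNat]

theorem continuous_e : Continuous e := by
  unfold e; fun_prop

theorem integral_e_int (n : ℤ) :
    ∫ α in (0 : ℝ)..1, e (α * n) = if n = 0 then 1 else 0 := by
  split_ifs with h
  · subst h; simp [e]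
  · have h1 : ∀ α : ℝ, e (α * n) = Complex.exp ((2 * Real.pi * Complex.I * n) * α) := by
      intro α; rw [e]; congr 1; push_cast; ring
    simp only [h1]
    have hn : (n : ℂ) ≠ 0 := by exact_mod_cast h
    rw [integral_exp_mul_complex (by simp [hn, Real.pi_ne_zero])]
    have h2 : Complex.exp (2 * Real.pi * Complex.I * n * (1 : ℝ)) = 1 :=
      Complex.exp_eq_one_iff.2 ⟨n, by push_cast; ring⟩
    rw [h2]; simp

/-- Parseval's identity for exponential sums with integer frequencies. -/
theorem integral_norm_sq_sum_e (T : Finset ℕ) (b : ℕ → ℤ) :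
    ∫ α in (0 : ℝ)..1, ‖∑ m ∈ T, e (α * b m)‖ ^ 2 =
      ∑ m' ∈ T, ((#{m ∈ T | b m = b m'} : ℕ) : ℝ) := by
  have h1 : ∀ α : ℝ, ((‖∑ m ∈ T, e (α * b m)‖ ^ 2 : ℝ) : ℂ) =
      ∑ m' ∈ T, ∑ m ∈ T, e (α * ((b m - b m' : ℤ) : ℝ)) := by
    intro α
    push_cast
    rw [← Complex.mul_conj', map_sum, sum_mul_sum, sum_comm]
    refine sum_congr rfl fun m' _ => sum_congr rfl fun m _ => ?_
    rw [conj_e, ← e_add]; congr 1; ring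
  have hc : ∀ n : ℤ, Continuous fun α : ℝ => e (α * (n : ℝ)) := fun n =>
    continuous_e.comp (by fun_prop)
  have h2 : ((∫ α in (0 : ℝ)..1, ‖∑ m ∈ T, e (α * b m)‖ ^ 2 : ℝ) : ℂ) =
      ((∑ m' ∈ T, ((#{m ∈ T | b m = b m'} : ℕ) : ℝ) : ℝ) : ℂ) := by
    rw [← intervalIntegral.integral_ofReal]
    simp only [h1]
    rw [intervalIntegral.integral_finsetSum fun m' _ =>
      (continuous_finsetSum _ fun m _ => hc _).intervalIntegrable _ _]
    rw [Complex.ofReal_sum]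
    refine sum_congr rfl fun m' _ => ?_
    rw [intervalIntegral.integral_finsetSum fun m _ => (hc _).intervalIntegrable _ _]
    simp only [integral_e_int, sub_eq_zero]
    rw [sum_boole, Complex.ofReal_natCast]
  exact_mod_cast h2

theorem kernel_mul_conj (g : ℕ → ℕ) (Y i N : ℕ) (α : ℝ) (p q m : ℕ) :
    kernel g Y i N α p m * conj (kernel g Y i N α q m) =
      if (p * m ≤ N ∧ ¬ p ∣ m ∧ Chained g Y i m) ∧ q * m ≤ N ∧ ¬ q ∣ m ∧ Chained g Y i m then
        e (α * (((g^[i + 1] (p * m) : ℤ) - (g^[i + 1] (q * m) : ℤ) : ℤ) : ℝ)) else 0 := by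
  rw [kernel, kernel]
  by_cases h1 : p * m ≤ N ∧ ¬ p ∣ m ∧ Chained g Y i m
  · by_cases h2 : q * m ≤ N ∧ ¬ q ∣ m ∧ Chained g Y i m
    · rw [if_pos h1, if_pos h2, if_pos ⟨h1, h2⟩, conj_e, ← e_add]
      congr 1; push_cast; ring
    · rw [if_neg h2, if_neg (fun h => h2 (And.right h)), map_zero, mul_zero]
  · rw [if_neg h1, zero_mul, if_neg (fun h => h1 (And.left h))]

theorem sum_kernel_mul_conj (g : ℕ → ℕ) (Y i N : ℕ) (p q M : ℕ) :
    ∃ T ⊆ ({m ∈ Icc 1 M | Chained g Y i m} : Finset ℕ), ∀ α : ℝ,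
      ∑ m ∈ Icc 1 M, kernel g Y i N α p m * conj (kernel g Y i N α q m) =
        ∑ m ∈ T, e (α * (((g^[i + 1] (p * m) : ℤ) - (g^[i + 1] (q * m) : ℤ) : ℤ) : ℝ)) := by
  refine ⟨{m ∈ Icc 1 M | (p * m ≤ N ∧ ¬ p ∣ m ∧ Chained g Y i m) ∧
    q * m ≤ N ∧ ¬ q ∣ m ∧ Chained g Y i m}, fun m hm => ?_, fun α => ?_⟩
  · obtain ⟨h1, h2⟩ := mem_filter.1 hm
    exact mem_filter.2 ⟨h1, h2.1.2.2⟩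
  · rw [sum_filter]
    exact sum_congr rfl fun m _ => kernel_mul_conj ..

theorem continuous_norm_sq_sum_kernel (g : ℕ → ℕ) (Y i N p q M : ℕ) :
    Continuous fun α : ℝ =>
      ‖∑ m ∈ Icc 1 M, kernel g Y i N α p m * conj (kernel g Y i N α q m)‖ ^ 2 := by
  obtain ⟨T, -, hT⟩ := sum_kernel_mul_conj g Y i N p q M
  simp only [hT]
  exact (continuous_finsetSum _ fun m _ => continuous_e.comp (by fun_prop)).norm.pow 2

theorem continuous_correlation (g : ℕ → ℕ) (Y i N j : ℕ) :
    Continuous (correlation g Y i N j) := by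
  unfold correlation
  exact continuous_finsetSum _ fun p _ => continuous_finsetSum _ fun q _ =>
    continuous_norm_sq_sum_kernel ..

theorem correlation_nonneg (g : ℕ → ℕ) (Y i N j : ℕ) (α : ℝ) : 0 ≤ correlation g Y i N j α :=
  sum_nonneg fun _ _ => sum_nonneg fun _ _ => by positivity

theorem integral_correlation_le {g : ℕ → ℕ} (hg : IsShiftLike g) (i : ℕ) :
    ∃ C : ℝ, 0 ≤ C ∧ ∀ Y N j w : ℕ, 3 ≤ Y → 1 ≤ w → N ≤ 2 ^ w → 16 ^ (j + 1) ≤ N →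
      ∫ α in (0 : ℝ)..1, correlation g Y i N j α ≤ C * w ^ (i + 1) * N ^ 2 / Y := by
  obtain ⟨C, hC, h⟩ := card_chained_solutions_le hg i
  refine ⟨512 * C, by positivity, fun Y N j w hY hw hN hj => ?_⟩
  set S := chainedPrimes g Y i j (j + 1) with hS
  set M := N / 16 ^ j with hM
  set D : ℝ := C * w ^ (i + 1) / Y with hD
  have hD0 : 0 ≤ D := by positivity
  have hMw : M ≤ 2 ^ w := (Nat.div_le_self _ _).trans hN
  have hjw : 16 ^ (j + 1) ≤ 2 ^ w := hj.trans hN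
  have hSmem : ∀ p ∈ S, p.Prime ∧ Chained g Y i p ∧ p ≤ 16 ^ (j + 1) := fun p hp =>
    ⟨(mem_filter.1 hp).2.1, (mem_filter.1 hp).2.2, (mem_Ico.1 (mem_filter.1 hp).1).2.le⟩
  set b : ℕ → ℕ → ℕ → ℤ := fun p q m => (g^[i + 1] (p * m) : ℤ) - (g^[i + 1] (q * m) : ℤ) with hb
  -- Parseval counts the `m` sharing the difference of a given `m'`. The count is small when that
  -- difference is nonzero; otherwise the trivial bound `M` is used.
  have h1 : ∀ p ∈ S, ∀ q ∈ S,
      ∫ α in (0 : ℝ)..1, ‖∑ m ∈ Icc 1 M,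
        kernel g Y i N α p m * conj (kernel g Y i N α q m)‖ ^ 2 ≤
      ∑ m' ∈ Icc 1 M, ((if g^[i + 1] (p * m') = g^[i + 1] (q * m') then (M : ℝ) else 0)
        + D * M) := by
    intro p hp q hq
    obtain ⟨T, hTs, hT⟩ := sum_kernel_mul_conj g Y i N p q M
    have hTM : T ⊆ Icc 1 M := hTs.trans (filter_subset _ _)
    simp only [hT]
    rw [integral_norm_sq_sum_e T (b p q)]
    refine (sum_le_sum fun m' hm' => ?_).trans
      (sum_le_sum_of_subset_of_nonneg hTM fun _ _ _ => by split_ifs <;> positivity)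
    split_ifs with heq
    · have h2 : #{m ∈ T | b p q m = b p q m'} ≤ M :=
        (card_filter_le _ _).trans ((card_le_card hTM).trans (by simp))
      have h3 : ((#{m ∈ T | b p q m = b p q m'} : ℕ) : ℝ) ≤ M := by exact_mod_cast h2
      have : 0 ≤ D * M := by positivity
      linarith
    · have hv : b p q m' ≠ 0 := fun h0 => heq (by exact_mod_cast sub_eq_zero.1 h0)
      have h2 := h Y w M p q 1 (-1) (b p q m') hY hw hMw (hSmem p hp).1.pos
        ((hSmem p hp).2.2.trans hjw) (hSmem q hq).1.pos ((hSmem q hq).2.2.trans hjw) hv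
      rw [zero_add]
      calc ((#{m ∈ T | b p q m = b p q m'} : ℕ) : ℝ) ≤ _ := by
            refine Nat.cast_le.2 (card_le_card fun m hm => ?_)
            obtain ⟨hm1, hm2⟩ := mem_filter.1 hm
            obtain ⟨hm3, hm4⟩ := mem_filter.1 (hTs hm1)
            refine mem_filter.2 ⟨hm3, hm4, ?_⟩
            rw [← hm2, hb]; ring
        _ ≤ C * w ^ (i + 1) * M / Y := h2
        _ = D * M := by rw [hD]; ring
  -- Zero differences: here the unknown is the chained prime `p` and `m'` is the multiplier, with
  -- coefficients `1, 0` and the positive right side `g^[i + 1] (q * m')`.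
  have h2 : ∀ q ∈ S, ∀ m' ∈ Icc 1 M,
      ∑ p ∈ S, (if g^[i + 1] (p * m') = g^[i + 1] (q * m') then (M : ℝ) else 0) ≤
        M * (D * 16 ^ (j + 1)) := by
    intro q hq m' hm'
    obtain ⟨hm1, hm2⟩ := mem_Icc.1 hm'
    have hv : (g^[i + 1] (q * m') : ℤ) ≠ 0 := by
      have := hg.iterate_pos (i + 1) (Nat.mul_pos (hSmem q hq).1.pos hm1)
      omega
    have h3 := h Y w (16 ^ (j + 1)) m' m' 1 0 _ hY hw hjw hm1 (hm2.trans hMw) hm1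
      (hm2.trans hMw) hv
    rw [← sum_filter, sum_const, nsmul_eq_mul, mul_comm]
    gcongr
    calc ((#{p ∈ S | g^[i + 1] (p * m') = g^[i + 1] (q * m')} : ℕ) : ℝ) ≤ _ := by
          refine Nat.cast_le.2 (card_le_card fun p hp => ?_)
          obtain ⟨hp1, hp2⟩ := mem_filter.1 hp
          obtain ⟨hp3, hp4, hp5⟩ := hSmem p hp1
          refine mem_filter.2 ⟨mem_Icc.2 ⟨hp3.pos, hp5⟩, hp4, ?_⟩
          rw [← hp2, mul_comm p m']; ring
      _ ≤ _ := h3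
      _ = D * 16 ^ (j + 1) := by rw [hD]; push_cast; ring
  have hintegral : ∀ p q, IntervalIntegrable (fun α : ℝ => ‖∑ m ∈ Icc 1 M,
        kernel g Y i N α p m * conj (kernel g Y i N α q m)‖ ^ 2) volume 0 1 := fun p q =>
    (continuous_norm_sq_sum_kernel g Y i N p q M).intervalIntegrable _ _
  have hScard : (S.card : ℝ) ≤ 16 ^ (j + 1) := by
    exact_mod_cast card_chainedPrimes_le g Y i j (j + 1)
  have hMN : (16 : ℝ) ^ (j + 1) * M ≤ 16 * N := by
    have : 16 ^ (j + 1) * M ≤ 16 * N := by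
      calc 16 ^ (j + 1) * M = 16 * (16 ^ j * (N / 16 ^ j)) := by rw [hM]; ring
        _ ≤ 16 * N := by gcongr; exact Nat.mul_div_le _ _
    exact_mod_cast this
  calc ∫ α in (0 : ℝ)..1, correlation g Y i N j α
      = ∑ p ∈ S, ∑ q ∈ S, ∫ α in (0 : ℝ)..1, ‖∑ m ∈ Icc 1 M,
          kernel g Y i N α p m * conj (kernel g Y i N α q m)‖ ^ 2 := by
        unfold correlation
        rw [intervalIntegral.integral_finsetSum fun p _ => (continuous_finsetSum _ fun q _ =>
          continuous_norm_sq_sum_kernel g Y i N p q M).intervalIntegrable _ _]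
        exact sum_congr rfl fun p _ =>
          intervalIntegral.integral_finsetSum fun q _ => hintegral p q
    _ ≤ ∑ p ∈ S, ∑ q ∈ S, ∑ m' ∈ Icc 1 M,
          ((if g^[i + 1] (p * m') = g^[i + 1] (q * m') then (M : ℝ) else 0) + D * M) :=
        sum_le_sum fun p hp => sum_le_sum fun q hq => h1 p hp q hq
    _ = ∑ q ∈ S, ∑ m' ∈ Icc 1 M, ∑ p ∈ S,
          ((if g^[i + 1] (p * m') = g^[i + 1] (q * m') then (M : ℝ) else 0) + D * M) := by
        rw [sum_comm]
        exact sum_congr rfl fun q _ => sum_comm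
    _ ≤ ∑ q ∈ S, ∑ m' ∈ Icc 1 M, (M * (D * 16 ^ (j + 1)) + 16 ^ (j + 1) * (D * M)) := by
        refine sum_le_sum fun q hq => sum_le_sum fun m' hm' => ?_
        rw [sum_add_distrib, sum_const, nsmul_eq_mul]
        gcongr
        exact h2 q hq m' hm'
    _ = S.card * (M * (2 * D * (16 ^ (j + 1) * M))) := by
        rw [sum_const, sum_const, Nat.card_Icc, Nat.add_sub_cancel, nsmul_eq_mul, nsmul_eq_mul]
        ring
    _ ≤ 16 ^ (j + 1) * (M * (2 * D * (16 ^ (j + 1) * M))) := by gcongr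
    _ = 2 * D * (16 ^ (j + 1) * M) ^ 2 := by ring
    _ ≤ 2 * D * (16 * N) ^ 2 := by gcongr
    _ = 512 * C * w ^ (i + 1) * N ^ 2 / Y := by rw [hD]; ring

/-! ### Choice of parameters -/

/-- The binary length of `N`. -/
def binaryLength (N : ℕ) : ℕ := Nat.log 2 N + 1

theorem lt_two_pow_binaryLength (N : ℕ) : N < 2 ^ binaryLength N :=
  Nat.lt_pow_succ_log_self (by norm_num) N

theorem two_pow_binaryLength_le {N : ℕ} (hN : 0 < N) : 2 ^ binaryLength N ≤ 2 * N := by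
  rw [binaryLength, pow_succ, mul_comm]
  exact Nat.mul_le_mul_left 2 (Nat.pow_log_le_self 2 hN.ne')

theorem one_le_binaryLength (N : ℕ) : 1 ≤ binaryLength N := Nat.succ_pos _

/-- The exponent of the threshold `2 ^ levelExponent i w ≥ w ^ (i + 10)` used for chains. -/
def levelExponent (i w : ℕ) : ℕ := (i + 10) * (Nat.log 2 w + 1)

theorem ten_le_levelExponent (i w : ℕ) : 10 ≤ levelExponent i w := by
  unfold levelExponent
  nlinarith [Nat.zero_le (Nat.log 2 w), Nat.zero_le i, Nat.zero_le (i * Nat.log 2 w)]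

theorem pow_le_two_pow_levelExponent (i w : ℕ) : w ^ (i + 10) ≤ 2 ^ levelExponent i w := by
  rw [levelExponent, mul_comm, pow_mul]
  exact Nat.pow_le_pow_left (Nat.lt_pow_succ_log_self (by norm_num) w).le _

theorem exists_levelExponent_pow_le_sqrt (i K : ℕ) :
    ∃ w₀ : ℕ, ∀ w ≥ w₀, levelExponent i w ^ K ≤ Nat.sqrt w := by
  have h1 := tendsto_pow_const_div_const_pow_of_one_lt (2 * K) (r := (2 : ℝ)) (by norm_num)
  have hc : (0 : ℝ) < 1 / (2 * ((i : ℝ) + 10) ^ (2 * K)) := by positivity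
  obtain ⟨n₀, hn₀⟩ := eventually_atTop.1 (h1.eventually (gt_mem_nhds hc))
  refine ⟨2 ^ n₀, fun w hw => ?_⟩
  have hw0 : w ≠ 0 := by have := Nat.one_le_two_pow (n := n₀); omega
  have hl : n₀ ≤ Nat.log 2 w := (Nat.le_log_iff_pow_le (by norm_num) hw0).2 hw
  set n := Nat.log 2 w + 1 with hn
  have h2 := hn₀ n (by omega)
  rw [div_lt_div_iff₀ (by positivity) (by positivity)] at h2
  rw [Nat.le_sqrt, ← sq]
  have h3 : ((levelExponent i w ^ K) ^ 2) ≤ 2 ^ Nat.log 2 w := by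
    have h4 : (((levelExponent i w ^ K) ^ 2 : ℕ) : ℝ) ≤ ((2 ^ Nat.log 2 w : ℕ) : ℝ) := by
      have h5 : (2 : ℝ) ^ n = 2 * 2 ^ Nat.log 2 w := by rw [hn]; ring
      rw [h5] at h2
      have h6 : ((((levelExponent i w) ^ K) ^ 2 : ℕ) : ℝ) =
          (n : ℝ) ^ (2 * K) * ((i : ℝ) + 10) ^ (2 * K) := by
        rw [levelExponent, ← hn]
        push_cast
        rw [← pow_mul, mul_comm K 2, mul_pow, mul_comm]
      rw [h6]
      push_cast
      linarith
    exact_mod_cast h4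
  exact h3.trans (Nat.pow_log_le_self 2 hw0)

/-- The normalised sum of the correlations over all blocks. -/
noncomputable def totalCorrelation (g : ℕ → ℕ) (i N : ℕ) (α : ℝ) : ℝ :=
  (binaryLength N : ℝ) ^ 4 *
    (∑ j ∈ Ico (Nat.sqrt (binaryLength N)) (binaryLength N / 8),
      correlation g (2 ^ levelExponent i (binaryLength N)) i N j α) / N ^ 2

theorem totalCorrelation_nonneg (g : ℕ → ℕ) (i N : ℕ) (α : ℝ) :
    0 ≤ totalCorrelation g i N α := by
  have := sum_nonneg fun j (_ : j ∈ Ico (Nat.sqrt (binaryLength N)) (binaryLength N / 8)) =>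
    correlation_nonneg g (2 ^ levelExponent i (binaryLength N)) i N j α
  unfold totalCorrelation
  positivity

theorem continuous_totalCorrelation (g : ℕ → ℕ) (i N : ℕ) :
    Continuous (totalCorrelation g i N) := by
  unfold totalCorrelation
  exact (continuous_const.mul (continuous_finsetSum _ fun j _ =>
    continuous_correlation _ _ _ _ _)).div_const _

theorem sixteen_pow_le {N j : ℕ} (hN : 0 < N) (hj : j ≤ binaryLength N / 8) : 16 ^ j ≤ N := by
  have h1 : 16 ^ j = 2 ^ (4 * j) := by rw [pow_mul]; norm_num
  rw [h1]
  have h2 : 4 * j ≤ Nat.log 2 N := by unfold binaryLength at hj; omega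
  exact (Nat.pow_le_pow_right (by norm_num) h2).trans (Nat.pow_log_le_self 2 hN.ne')

/-- The losses are `w ^ (i + 1)` from the counting, `w` from the number of blocks and `w ^ 4` from
the normalisation; the threshold gains `w ^ (i + 10)`. -/
theorem integral_totalCorrelation_le {g : ℕ → ℕ} (hg : IsShiftLike g) (i : ℕ) :
    ∃ C : ℝ, 0 ≤ C ∧ ∀ N : ℕ, 0 < N →
      ∫ α in (0 : ℝ)..1, totalCorrelation g i N α ≤ C / (binaryLength N : ℝ) ^ 4 := by
  obtain ⟨C, hC, h⟩ := integral_correlation_le hg i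
  refine ⟨C, hC, fun N hN => ?_⟩
  set w := binaryLength N with hw
  set V := levelExponent i w with hV
  have hw1 : 1 ≤ w := one_le_binaryLength N
  have hw1' : (1 : ℝ) ≤ w := by exact_mod_cast hw1
  have hN0 : (0 : ℝ) < N := by exact_mod_cast hN
  have hV10 : 10 ≤ V := ten_le_levelExponent i w
  have hY : 3 ≤ 2 ^ V :=
    le_trans (by norm_num) (Nat.pow_le_pow_right (n := 2) (by norm_num) hV10)
  have hYw : (w : ℝ) ^ (i + 10) ≤ ((2 ^ V : ℕ) : ℝ) := by
    exact_mod_cast pow_le_two_pow_levelExponent i w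
  have h1 : ∀ j ∈ Ico (Nat.sqrt w) (w / 8),
      ∫ α in (0 : ℝ)..1, correlation g (2 ^ V) i N j α ≤
        C * N ^ 2 * w ^ (i + 1) / w ^ (i + 10) := by
    intro j hj
    refine (h (2 ^ V) N j w hY hw1 (lt_two_pow_binaryLength N).le
      (sixteen_pow_le hN (mem_Ico.1 hj).2)).trans ?_
    rw [mul_right_comm]
    gcongr
  have h2 : ∫ α in (0 : ℝ)..1, totalCorrelation g i N α =
      w ^ 4 * (∑ j ∈ Ico (Nat.sqrt w) (w / 8),
        ∫ α in (0 : ℝ)..1, correlation g (2 ^ V) i N j α) / N ^ 2 := by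
    unfold totalCorrelation
    rw [intervalIntegral.integral_div, intervalIntegral.integral_const_mul,
      intervalIntegral.integral_finsetSum fun j _ =>
        (continuous_correlation _ _ _ _ _).intervalIntegrable _ _]
  have h3 : ∑ j ∈ Ico (Nat.sqrt w) (w / 8),
      ∫ α in (0 : ℝ)..1, correlation g (2 ^ V) i N j α ≤
        w * (C * N ^ 2 * w ^ (i + 1) / w ^ (i + 10)) := by
    refine (sum_le_sum h1).trans ?_
    rw [sum_const, nsmul_eq_mul, Nat.card_Ico]
    gcongr
    omega
  rw [h2]
  calc (w : ℝ) ^ 4 * (∑ j ∈ Ico (Nat.sqrt w) (w / 8),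
        ∫ α in (0 : ℝ)..1, correlation g (2 ^ V) i N j α) / N ^ 2
      ≤ w ^ 4 * (w * (C * N ^ 2 * w ^ (i + 1) / w ^ (i + 10))) / N ^ 2 := by gcongr
    _ = C * (w ^ (i + 6) / w ^ (i + 10)) := by field_simp; ring
    _ = C / w ^ 4 := by
      rw [show i + 10 = (i + 6) + 4 by ring, pow_add (w : ℝ) (i + 6) 4]
      field_simp

/-- As `p ≤ 2 ^ (w / 2)`, the quotient `N / p` still has binary length at least `w / 2`. The `4` is
`2` from this halving times `2` from rounding up to a power of two. -/
theorem card_not_chained_div_le {g : ℕ → ℕ} {i N D Y p : ℕ} {C : ℝ} (hC : 0 ≤ C)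
    (h : ∀ w, D ≤ w → ((#{m ∈ Icc 1 (2 ^ w) | ¬ Chained g Y i m} : ℕ) : ℝ) ≤ C * 2 ^ w / w ^ 1)
    (hN : 0 < N) (hD : D ≤ binaryLength N / 2) (hp : 0 < p)
    (hpN : p ≤ 16 ^ (binaryLength N / 8)) :
    ((#{m ∈ Icc 1 (N / p) | ¬ Chained g Y i m} : ℕ) : ℝ) ≤
      (4 * C / binaryLength N) * (N / p) := by
  set w := binaryLength N with hw
  set b := w / 8 with hb
  have hw1 : 1 ≤ w := one_le_binaryLength N
  have hw0 : (0 : ℝ) < w := by exact_mod_cast hw1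
  have hp0 : (0 : ℝ) < p := by exact_mod_cast hp
  have h16 : (16 : ℕ) ^ b = 2 ^ (4 * b) := by rw [pow_mul]; norm_num
  set n := N / p with hn
  have hn2 : 2 ^ (w - 1 - 4 * b) ≤ n := by
    rw [hn, Nat.le_div_iff_mul_le hp]
    calc 2 ^ (w - 1 - 4 * b) * p ≤ 2 ^ (w - 1 - 4 * b) * 2 ^ (4 * b) := by
          rw [← h16]; exact Nat.mul_le_mul_left _ hpN
      _ = 2 ^ (w - 1) := by rw [← pow_add]; congr 1; omega
      _ ≤ N := by
        rw [hw, binaryLength, Nat.add_sub_cancel]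
        exact Nat.pow_log_le_self 2 hN.ne'
  have hn0 : 0 < n := lt_of_lt_of_le (by positivity) hn2
  set w' := binaryLength n with hw'
  have hww' : w ≤ 2 * w' := by
    have : w - 1 - 4 * b ≤ Nat.log 2 n :=
      (Nat.le_log_iff_pow_le (by norm_num) hn0.ne').2 hn2
    have h4 : w' = Nat.log 2 n + 1 := rfl
    omega
  have hw'0 : (0 : ℝ) < w' := by exact_mod_cast one_le_binaryLength n
  calc ((#{m ∈ Icc 1 n | ¬ Chained g Y i m} : ℕ) : ℝ)
      ≤ ((#{m ∈ Icc 1 (2 ^ w') | ¬ Chained g Y i m} : ℕ) : ℝ) := by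
        gcongr
        exact (lt_two_pow_binaryLength n).le
    _ ≤ C * 2 ^ w' / w' ^ 1 := h w' (by omega)
    _ ≤ C * (2 * n) / w' := by
        rw [pow_one]
        gcongr
        exact_mod_cast two_pow_binaryLength_le hn0
    _ ≤ C * (2 * (N / p)) / w' := by
        gcongr
        exact Nat.cast_div_le
    _ ≤ C * (2 * (N / p)) / (w / 2) := by
        gcongr
        have : (w : ℝ) ≤ 2 * w' := by exact_mod_cast hww'
        linarith
    _ = (4 * C / w) * (N / p) := by field_simp; ring

/-- If the correlations are small then so is the mean value, uniformly in `f`. -/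
theorem exists_norm_twisted_sum_le {g : ℕ → ℕ} (hg : IsShiftLike g) (i : ℕ) {θ : ℝ} (hθ : 0 < θ) :
    ∃ w₀ : ℕ, ∀ N : ℕ, 0 < N → w₀ ≤ binaryLength N → ∀ α : ℝ,
      256 * totalCorrelation g i N α ≤ θ ^ 4 → ∀ f ∈ M₁,
        ‖∑ n ∈ Icc 1 N, f n * e (α * (g^[i + 1] n : ℝ))‖ ≤ 4 * θ * N := by
  obtain ⟨K₁, C₁, h₁⟩ := sum_chainedPrimes_inv_ge hg i
  obtain ⟨K₂, C₂, -, hC₂, h₂⟩ := card_not_chained_le hg i 1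
  obtain ⟨w₁, hw₁⟩ := exists_levelExponent_pow_le_sqrt i K₁
  obtain ⟨w₂, hw₂⟩ := exists_levelExponent_pow_le_sqrt i K₂
  -- The bound `L ≥ 3 / θ ^ 2` makes the Turán–Kubilius error `√(3 * L)` at most `θ * L`; `L ≥ 1`
  -- absorbs the bilinear term, which is at most `θ`.
  obtain ⟨a₀, ha₀⟩ : ∃ a₀ : ℕ, ∀ a : ℕ, a₀ ≤ a →
      max 1 (3 / θ ^ 2) ≤ Real.log ((a : ℝ) / 16) / 48 - C₁ ∧
        1 / (a : ℝ) ≤ θ ∧ 4 * C₂ / (a : ℝ) ≤ θ := by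
    have hl : Tendsto (fun a : ℕ => Real.log ((a : ℝ) / 16) / 48 - C₁) atTop atTop :=
      tendsto_atTop_add_const_right _ _ ((Real.tendsto_log_atTop.comp
        (tendsto_natCast_atTop_atTop.atTop_div_const (by norm_num))).atTop_div_const (by norm_num))
    have h1 := hl.eventually_ge_atTop (max 1 (3 / θ ^ 2))
    have h2 := (tendsto_const_div_atTop_nhds_zero_nat (1 : ℝ)).eventually (ge_mem_nhds hθ)
    have h3 := (tendsto_const_div_atTop_nhds_zero_nat (4 * C₂)).eventually (ge_mem_nhds hθ)
    obtain ⟨a₀, h⟩ := eventually_atTop.1 (h1.and (h2.and h3))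
    exact ⟨a₀, h⟩
  refine ⟨max (max w₁ w₂) (max 64 (a₀ ^ 2)), fun N hN hw α hα f hf => ?_⟩
  set w := binaryLength N with hwdef
  set V := levelExponent i w with hV
  -- The ratio `b / a` grows like `√w`, so `L` tends to infinity, while `a` still exceeds any fixed
  -- power of `V`, which is of order `log w`.
  set a := Nat.sqrt w with ha
  set b := w / 8 with hb
  simp only [max_le_iff] at hw
  obtain ⟨⟨hww₁, hww₂⟩, hw64, hwa₀⟩ := hw
  have hV2 : 2 ≤ V := le_trans (by norm_num) (ten_le_levelExponent i w)
  have haw : a * a ≤ w := Nat.sqrt_le w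
  have hwa : w ≤ a * a + a + a := Nat.sqrt_le_add w
  have ha8 : 8 ≤ a := Nat.le_sqrt.2 hw64
  have haa₀ : a₀ ≤ a := Nat.le_sqrt.2 (by rw [← sq]; exact hwa₀)
  have hab : a ≤ b := by
    rw [hb, Nat.le_div_iff_mul_le (by norm_num)]
    nlinarith
  have hba : b ≤ a ^ 2 := by
    have : b ≤ w / 8 := le_rfl
    have h3 : w ≤ 3 * a ^ 2 := by nlinarith
    omega
  obtain ⟨hL1, ha1, ha2⟩ := ha₀ a haa₀
  have ha0 : (0 : ℝ) < a := by exact_mod_cast (show 0 < a by omega)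
  have hw0 : (0 : ℝ) < w := by exact_mod_cast (show 0 < w by omega)
  have hN0 : (0 : ℝ) < N := by exact_mod_cast hN
  set P := chainedPrimes g (2 ^ V) i a b with hP
  set L := ∑ p ∈ P, (1 : ℝ) / p with hL
  have hLge : max 1 (3 / θ ^ 2) ≤ L := by
    refine hL1.trans (le_trans ?_ (h₁ V a b hV2 (by omega) (hw₁ w hww₁) hab hba))
    have h3 : a * (a + 1) ≤ (b + 1) * 16 := by
      have : w < 8 * (b + 1) := by omega
      nlinarith
    have h4 : (a : ℝ) / 16 ≤ (b + 1) / (a + 1) := by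
      rw [div_le_div_iff₀ (by norm_num) (by positivity)]
      exact_mod_cast h3
    have h5 := Real.log_le_log (by positivity) h4
    linarith
  have hL1' : 1 ≤ L := (le_max_left _ _).trans hLge
  have hL0 : 0 < L := by linarith
  have hLθ : 3 ≤ θ ^ 2 * L := by
    have := (le_max_right _ _).trans hLge
    rwa [div_le_iff₀ (by positivity), mul_comm] at this
  have haw' : (a : ℝ) ≤ w := by
    exact_mod_cast (show a ≤ w by nlinarith)
  have hU : ∀ p ∈ P, ((#{m ∈ Icc 1 (N / p) | ¬ Chained g (2 ^ V) i m} : ℕ) : ℝ) ≤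
      (4 * C₂ / w) * (N / p) := fun p hp =>
    card_not_chained_div_le hC₂ (h₂ V · hV2) hN ((hw₂ w hww₂).trans (show a ≤ w / 2 by
      have : 2 * a ≤ w := by nlinarith
      omega)) (mem_filter.1 hp).2.1.pos (mem_Ico.1 (mem_filter.1 hp).1).2.le
  have hQ : ∀ j ∈ Ico a b, 256 * correlation g (2 ^ V) i N j α ≤ (θ / w) ^ 4 * N ^ 2 := by
    intro j hj
    have h3 : correlation g (2 ^ V) i N j α ≤ ∑ j ∈ Ico a b, correlation g (2 ^ V) i N j α :=
      single_le_sum (f := fun j => correlation g (2 ^ V) i N j α)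
        (fun j _ => correlation_nonneg _ _ _ _ _ _) hj
    have h4 : totalCorrelation g i N α = w ^ 4 *
      (∑ j ∈ Ico a b, correlation g (2 ^ V) i N j α) / N ^ 2 := rfl
    rw [h4, mul_div_assoc', div_le_iff₀ (by positivity)] at hα
    rw [div_pow, div_mul_eq_mul_div, le_div_iff₀ (by positivity)]
    calc 256 * correlation g (2 ^ V) i N j α * (w : ℝ) ^ 4
        ≤ 256 * (∑ j ∈ Ico a b, correlation g (2 ^ V) i N j α) * (w : ℝ) ^ 4 := by gcongr
      _ = 256 * ((w : ℝ) ^ 4 * ∑ j ∈ Ico a b, correlation g (2 ^ V) i N j α) := by ring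
      _ ≤ _ := hα
  have hmain := norm_twisted_sum_le hf hab (sixteen_pow_le hN le_rfl) (by positivity) hU hQ
  rw [← hP, ← hL] at hmain
  clear_value L
  have hsqrt : √(3 * L) ≤ θ * L := by
    refine Real.sqrt_le_iff.2 ⟨(mul_pos hθ hL0).le, ?_⟩
    calc 3 * L ≤ θ ^ 2 * L * L := by gcongr
      _ = (θ * L) ^ 2 := by ring
  have h16 : (1 : ℝ) / 16 ^ a ≤ θ := by
    refine le_trans ?_ ha1
    gcongr
    have h3 : a < 16 ^ a := Nat.lt_pow_self (by norm_num)
    exact_mod_cast h3.le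
  have hε : 4 * C₂ / (w : ℝ) ≤ θ :=
    (div_le_div_of_nonneg_left (by positivity) ha0 haw').trans ha2
  have hbη : (b : ℝ) * (θ / w) ≤ θ * L := by
    have h3 : (b : ℝ) ≤ w := by exact_mod_cast Nat.div_le_self w 8
    calc (b : ℝ) * (θ / w) ≤ w * (θ / w) := by gcongr
      _ = θ * 1 := by field_simp
      _ ≤ θ * L := by gcongr
  refine le_of_mul_le_mul_left (hmain.trans ?_) hL0
  calc (N : ℝ) * (√(3 * L) + (1 / 16 ^ a + 4 * C₂ / w) * L + b * (θ / w))
      ≤ N * (θ * L + (θ + θ) * L + θ * L) := by gcongr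
    _ = L * (4 * θ * N) := by ring

/-! ### Almost every `α`: a sparse sequence and the gaps -/

/-- By Tonelli the sum of the `F s` has finite integral, so it converges almost everywhere and its
terms tend to zero. -/
theorem ae_tendsto_zero_of_summable_integral {F : ℕ → ℝ → ℝ} (hc : ∀ s, Continuous (F s))
    (hF : ∀ s α, 0 ≤ F s α) {c : ℕ → ℝ} (hsum : Summable c)
    (hintegral : ∀ s, ∫ α in (0 : ℝ)..1, F s α ≤ c s) :
    ∀ᵐ α ∂(volume.restrict (Set.Ioo (0 : ℝ) 1)), Tendsto (fun s => F s α) atTop (𝓝 0) := by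
  set μ := volume.restrict (Set.Ioo (0 : ℝ) 1) with hμ
  have h1 : ∀ s, ∫⁻ α, ENNReal.ofReal (F s α) ∂μ ≤ ENNReal.ofReal (c s) := by
    intro s
    have hi : Integrable (F s) μ :=
      ((hc s).integrableOn_Icc (a := 0) (b := 1)).mono_set Set.Ioo_subset_Icc_self
    rw [← ofReal_integral_eq_lintegral_ofReal hi (Eventually.of_forall (hF s))]
    refine ENNReal.ofReal_le_ofReal (le_trans (le_of_eq ?_) (hintegral s))
    rw [intervalIntegral.integral_of_le zero_le_one, integral_Ioc_eq_integral_Ioo]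
  have h2 : ∫⁻ α, ∑' s, ENNReal.ofReal (F s α) ∂μ ≠ ⊤ := by
    rw [lintegral_tsum fun s => ((hc s).measurable.ennreal_ofReal).aemeasurable]
    exact ne_top_of_le_ne_top hsum.tsum_ofReal_ne_top (ENNReal.tsum_le_tsum h1)
  have h3 : Measurable fun α => ∑' s, ENNReal.ofReal (F s α) :=
    Measurable.tsum fun s => (hc s).measurable.ennreal_ofReal
  filter_upwards [ae_lt_top h3 h2] with α hα
  have h4 := ENNReal.tendsto_atTop_zero_of_tsum_ne_top hα.ne
  have h5 := (ENNReal.tendsto_toReal ENNReal.zero_ne_top).comp h4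
  simpa [Function.comp_def, ENNReal.toReal_ofReal (hF _ α)] using h5

/-- A sequence of superpolynomial growth whose consecutive ratios tend to one. -/
noncomputable def sample (s : ℕ) : ℕ := ⌊Real.exp √s⌋₊

theorem sample_pos (s : ℕ) : 0 < sample s :=
  Nat.floor_pos.2 (Real.one_le_exp (Real.sqrt_nonneg _))

theorem sqrt_le_binaryLength_sample (s : ℕ) : √(s : ℝ) ≤ binaryLength (sample s) := by
  have h1 : Real.exp √s < sample s + 1 := Nat.lt_floor_add_one _
  have h2 : ((sample s + 1 : ℕ) : ℝ) ≤ ((2 ^ binaryLength (sample s) : ℕ) : ℝ) :=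
    Nat.cast_le.2 (lt_two_pow_binaryLength (sample s))
  push_cast at h2
  have h3 : √(s : ℝ) ≤ Real.log (2 ^ binaryLength (sample s)) :=
    (Real.le_log_iff_exp_le (by positivity)).2 (h1.le.trans h2)
  rw [Real.log_pow] at h3
  have h4 : (0 : ℝ) ≤ binaryLength (sample s) := Nat.cast_nonneg _
  nlinarith [Real.log_two_lt_d9]

theorem ae_tendsto_totalCorrelation_sample {g : ℕ → ℕ} (hg : IsShiftLike g) (i : ℕ) :
    ∀ᵐ α ∂(volume.restrict (Set.Ioo (0 : ℝ) 1)),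
      Tendsto (fun s => totalCorrelation g i (sample s) α) atTop (𝓝 0) := by
  obtain ⟨C, hC, h⟩ := integral_totalCorrelation_le hg i
  have hsum : Summable fun s : ℕ => 4 * C * (1 / ((s + 1 : ℕ) : ℝ) ^ 2) :=
    ((summable_nat_add_iff 1).2 (Real.summable_one_div_nat_pow.2 one_lt_two)).mul_left _
  refine ae_tendsto_zero_of_summable_integral (fun s => continuous_totalCorrelation g i _)
    (fun s => totalCorrelation_nonneg g i _) hsum fun s => (h _ (sample_pos s)).trans ?_
  have h1 := sqrt_le_binaryLength_sample s
  have h2 : (1 : ℝ) ≤ binaryLength (sample s) := by exact_mod_cast one_le_binaryLength _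
  set w : ℝ := (binaryLength (sample s) : ℝ) with hw
  have h3 : ((s + 1 : ℕ) : ℝ) ≤ 2 * w ^ 2 := by
    have := Real.sqrt_le_left (show (0 : ℝ) ≤ w by linarith) |>.1 h1
    push_cast
    nlinarith
  have h4 : ((s + 1 : ℕ) : ℝ) ^ 2 ≤ 4 * w ^ 4 := by
    calc ((s + 1 : ℕ) : ℝ) ^ 2 ≤ (2 * w ^ 2) ^ 2 := by gcongr
      _ = 4 * w ^ 4 := by ring
  rw [mul_one_div, div_le_div_iff₀ (by positivity) (by positivity)]
  calc C * ((s + 1 : ℕ) : ℝ) ^ 2 ≤ C * (4 * w ^ 4) := by gcongr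
    _ = 4 * C * w ^ 4 := by ring

/-- Since `√(s + 1) - √s ≤ 1 / √(s + 1)`, the relative gap between `N` and `exp √s` is at most `1 /
√(s + 1)`. The floor loses at most as much again, hence the `2`. -/
theorem exists_sample_near {N : ℕ} (hN : 0 < N) {s : ℕ} (hs : s = ⌊Real.log N ^ 2⌋₊) :
    sample s ≤ N ∧ (N : ℝ) - sample s ≤ 2 / √((s : ℝ) + 1) * N := by
  have hN1 : (1 : ℝ) ≤ N := by exact_mod_cast hN
  have hN0 : (0 : ℝ) < N := by linarith
  have hlog : 0 ≤ Real.log N := Real.log_nonneg hN1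
  have h1 : √(s : ℝ) ≤ Real.log N := by
    refine Real.sqrt_le_iff.2 ⟨hlog, ?_⟩
    rw [hs]; exact Nat.floor_le (by positivity)
  have h2 : Real.log N ≤ √((s : ℝ) + 1) := by
    refine Real.le_sqrt_of_sq_le ?_
    rw [hs]; exact (Nat.lt_floor_add_one _).le
  have h3 : Real.exp √s ≤ N := by
    rw [← Real.exp_log hN0]; exact Real.exp_le_exp.2 h1
  have h4 : (N : ℝ) ≤ Real.exp √((s : ℝ) + 1) := by
    rw [← Real.exp_log hN0]; exact Real.exp_le_exp.2 h2
  set r := √((s : ℝ) + 1) with hr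
  have hs0 : (0 : ℝ) ≤ s := Nat.cast_nonneg s
  have hr0 : 0 < r := Real.sqrt_pos.2 (by positivity)
  have hrs : r ^ 2 = s + 1 := Real.sq_sqrt (by positivity)
  have hss : √(s : ℝ) ^ 2 = s := Real.sq_sqrt hs0
  have hq0 : 0 ≤ √(s : ℝ) := Real.sqrt_nonneg _
  have hr1 : 1 ≤ r := by
    rw [hr]; exact Real.one_le_sqrt.2 (by linarith)
  have h5 : r - √(s : ℝ) ≤ 1 / r := by
    rw [le_div_iff₀ hr0]
    have : √(s : ℝ) ≤ r := Real.sqrt_le_sqrt (by linarith)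
    nlinarith
  have h6 : (1 - 1 / r) * N ≤ Real.exp √s := by
    have h7 : 1 - 1 / r ≤ Real.exp (√s - r) := by
      have := Real.add_one_le_exp (√(s : ℝ) - r)
      linarith
    have h8 : 0 ≤ 1 - 1 / r := by
      rw [sub_nonneg, div_le_one hr0]; exact hr1
    calc (1 - 1 / r) * N ≤ Real.exp (√s - r) * Real.exp r := by gcongr
      _ = Real.exp √s := by rw [← Real.exp_add]; congr 1; ring
  have h7 : r ≤ N := by
    have h8 := Real.add_one_le_exp √(s : ℝ)
    have h9 : r ≤ √s + 1 := by
      refine Real.sqrt_le_iff.2 ⟨by positivity, ?_⟩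
      nlinarith
    linarith
  have h8 : 1 ≤ 1 / r * N := by
    rw [one_div_mul_eq_div, one_le_div hr0]; exact h7
  have h9 : Real.exp √s < sample s + 1 := Nat.lt_floor_add_one _
  refine ⟨?_, ?_⟩
  · exact Nat.floor_le_of_le h3
  · have h10 : 2 / r * N = 1 / r * N + 1 / r * N := by ring
    rw [h10]
    linarith

theorem norm_twisted_sum_le_add {a : ℕ → ℕ} {α : ℝ} {f : ArithmeticFunction ℂ} (hf : f ∈ M₁)
    {M N : ℕ} (h : M ≤ N) :
    ‖∑ n ∈ Icc 1 N, f n * e (α * (a n : ℝ))‖ ≤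
      ‖∑ n ∈ Icc 1 M, f n * e (α * (a n : ℝ))‖ + ((N : ℝ) - M) := by
  have hsub : Icc 1 M ⊆ Icc 1 N := Icc_subset_Icc_right h
  rw [← sum_sdiff hsub, add_comm]
  refine (norm_add_le _ _).trans (add_le_add_right ?_ _)
  calc ‖∑ n ∈ Icc 1 N \ Icc 1 M, f n * e (α * (a n : ℝ))‖
      ≤ ∑ n ∈ Icc 1 N \ Icc 1 M, (1 : ℝ) := by
        refine norm_sum_le_of_le _ fun n hn => ?_
        rw [norm_mul, norm_e, mul_one, hf.2 n (mem_Icc.1 (mem_sdiff.1 hn).1).1]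
    _ = (N : ℝ) - M := by
        rw [sum_const, nsmul_eq_mul, mul_one, card_sdiff_of_subset hsub, Nat.card_Icc,
          Nat.card_Icc, Nat.add_sub_cancel, Nat.add_sub_cancel, Nat.cast_sub h]

/-- The exceptional null set depends only on the sampled correlations, so it serves every `ε` and
`f` at once. -/
theorem ae_eventually_norm_twisted_sum_le {g : ℕ → ℕ} (hg : IsShiftLike g) (i : ℕ) :
    ∀ᵐ α ∂(volume.restrict (Set.Ioo (0 : ℝ) 1)), ∀ ε : ℝ, 0 < ε → ∀ᶠ N : ℕ in atTop,
      ∀ f ∈ M₁, ‖∑ n ∈ Icc 1 N, f n * e (α * (g^[i + 1] n : ℝ))‖ ≤ ε * N := by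
  filter_upwards [ae_tendsto_totalCorrelation_sample hg i] with α hα ε hε
  -- The sampled sum then costs `4 * θ = ε / 2`, and the gap up to `N` the other half.
  set θ := ε / 8 with hθ
  have hθ0 : 0 < θ := by positivity
  obtain ⟨w₀, hw₀⟩ := exists_norm_twisted_sum_le hg i hθ0
  have hsqrt : Tendsto (fun s : ℕ => √(s : ℝ)) atTop atTop :=
    Real.tendsto_sqrt_atTop.comp tendsto_natCast_atTop_atTop
  have h1 : ∀ᶠ s : ℕ in atTop, totalCorrelation g i (sample s) α ≤ θ ^ 4 / 256 :=
    hα.eventually (ge_mem_nhds (by positivity))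
  have h2 : ∀ᶠ s : ℕ in atTop, (w₀ : ℝ) ≤ √(s : ℝ) := hsqrt.eventually_ge_atTop _
  have h3 : ∀ᶠ s : ℕ in atTop, 4 / ε ≤ √(s : ℝ) := hsqrt.eventually_ge_atTop _
  have hfloor : Tendsto (fun N : ℕ => ⌊Real.log N ^ 2⌋₊) atTop atTop :=
    tendsto_nat_floor_atTop.comp ((tendsto_pow_atTop two_ne_zero).comp
      (Real.tendsto_log_atTop.comp tendsto_natCast_atTop_atTop))
  filter_upwards [hfloor.eventually (h1.and (h2.and h3)), eventually_gt_atTop 0] with N hN hN0 f hf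
  obtain ⟨hN1, hN2, hN3⟩ := hN
  set s := ⌊Real.log N ^ 2⌋₊ with hs
  obtain ⟨h4, h5⟩ := exists_sample_near hN0 hs
  have hN0' : (0 : ℝ) < N := by exact_mod_cast hN0
  have h6 := hw₀ (sample s) (sample_pos s)
    (by exact_mod_cast hN2.trans (sqrt_le_binaryLength_sample s)) α (by linarith) f hf
  have h7 : (sample s : ℝ) ≤ N := by exact_mod_cast h4
  have h8 : 2 / √((s : ℝ) + 1) ≤ ε / 2 := by
    have h9 : 4 / ε ≤ √((s : ℝ) + 1) := hN3.trans (Real.sqrt_le_sqrt (by linarith))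
    have h10 : 0 < √((s : ℝ) + 1) := lt_of_lt_of_le (by positivity) h9
    rw [div_le_iff₀ hε] at h9
    rw [div_le_iff₀ h10]
    linarith
  calc ‖∑ n ∈ Icc 1 N, f n * e (α * (g^[i + 1] n : ℝ))‖
      ≤ ‖∑ n ∈ Icc 1 (sample s), f n * e (α * (g^[i + 1] n : ℝ))‖ + ((N : ℝ) - sample s) :=
        norm_twisted_sum_le_add hf h4
    _ ≤ 4 * θ * N + ε / 2 * N := by
        refine add_le_add (h6.trans (by gcongr)) (h5.trans (by gcongr))
    _ = ε * N := by rw [hθ]; ring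

theorem tendsto_supTwistedMean {a : ℕ → ℕ} {α : ℝ}
    (h : ∀ ε : ℝ, 0 < ε → ∀ᶠ N : ℕ in atTop, ∀ f ∈ M₁,
      ‖∑ n ∈ Icc 1 N, f n * e (α * (a n : ℝ))‖ ≤ ε * N) :
    Tendsto (fun x : ℝ => supTwistedMean a α x) atTop (𝓝 0) := by
  refine Metric.tendsto_nhds.2 fun ε hε => ?_
  have hfl : Tendsto (fun x : ℝ => ⌊x⌋₊) atTop atTop := tendsto_nat_floor_atTop
  filter_upwards [hfl.eventually (h (ε / 2) (by positivity)), eventually_gt_atTop 0] with x hx hx0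
  have h0 : 0 ≤ supTwistedMean a α x := by
    refine Real.sSup_nonneg ?_
    rintro _ ⟨f, -, rfl⟩
    unfold twistedMean
    positivity
  have h1 : supTwistedMean a α x ≤ ε / 2 := by
    refine csSup_le (M₁_nonempty.image _) ?_
    rintro _ ⟨f, hf, rfl⟩
    rw [twistedMean, one_div, inv_mul_le_iff₀ hx0, mul_comm]
    refine (hx f hf).trans ?_
    gcongr
    exact Nat.floor_le hx0.le
  rw [Real.dist_eq, sub_zero, abs_of_nonneg h0]
  linarith

end IterateSums

theorem theoremB (k : ℕ) (hk : 1 ≤ k) :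
    ∀ᵐ α ∂(volume.restrict (Set.Ioo (0 : ℝ) 1)),
      Tendsto (fun x : ℝ => IterateSums.supTwistedMean (IterateSums.phiIter k) α x)
        atTop (𝓝 0) ∧
      Tendsto (fun x : ℝ => IterateSums.supTwistedMean (IterateSums.sigmaIter k) α x)
        atTop (𝓝 0) := by
  obtain ⟨i, rfl⟩ : ∃ i, k = i + 1 := ⟨k - 1, by omega⟩
  filter_upwards [
    IterateSums.ae_eventually_norm_twisted_sum_le IterateSums.isShiftLike_totient i,
    IterateSums.ae_eventually_norm_twisted_sum_le IterateSums.isShiftLike_sigma i] with α h₁ h₂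
  exact ⟨IterateSums.tendsto_supTwistedMean h₁, IterateSums.tendsto_supTwistedMean h₂⟩
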